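/- Conventions. Fix a universe of sets, let $Set$ be the category of its sets and maps, and let $SSet$ be the category of functors $\Delta^{op}\to Set$. These categories are small with respect to a larger universe, and $Cat$ is the category of categories that are small with respect to that larger universe. Let $\underline{Cat}$ be the category whose objects are pairs $\underline{D}=(D,R)$ with $D$ a small category and $R:D\to Cat$ a functor, and whose morphisms $(D,R)\to(D',R')$ are pairs $(F,\rho)$ with $F:D\to D'$ a functor and $\rho:R'F\Rightarrow R$ a natural transformation. For $\underline{D}=(D,R)$, $\underline{D}'=(D',R')$, $d\in D$ and a functor $\psi:R(d)\to D'$, let $R(d)\ltimes_\psi\underline{D}'$ be the category whose objects are pairs $(a,b)$ with $a\in R(d)$, $b\in R'(\psi(a))$, whose morphisms $(a_1,b_1)\to(a_2,b_2)$ are pairs $(\alpha:a_1\to a_2,\ \beta:R'(\psi(\alpha))(b_1)\to b_2)$, and whose composition is $(\alpha_2,\beta_2)(\alpha_1,\beta_1)=(\alpha_2\alpha_1,\ \beta_2\, R'\psi(\alpha_2)(\beta_1))$. Let $D\ltimes D'$ be the category whose objects are pairs $(d,\psi:R(d)\to D')$ and whose morphisms $(d_1,\psi_1)\to(d_2,\psi_2)$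 are pairs $(f:d_1\to d_2,\ \phi:\psi_1\Rightarrow\psi_2R(f))$. The semi-direct product is $\underline{D}\ltimes\underline{D}'=(D\ltimes D',R\ltimes R')$, where $(R\ltimes R')(d,\psi)=R(d)\ltimes_\psi\underline{D}'$ and $(R\ltimes R')(f,\phi)$ is the functor $(a,b)\mapsto(R(f)(a),R'(\phi_a)(b))$, $(\alpha,\beta)\mapsto(R(f)(\alpha),R'(\phi_{a_2})(\beta))$. Let $\underline{\mathbf 1}$ be the discrete category on one object, mapped to itself in $Cat$. With the evident action of $\ltimes$ on morphisms and the canonical morphisms $(\underline D\ltimes\underline D')\ltimes\underline D''\to\underline D\ltimes(\underline D'\ltimes\underline D'')$, $\underline{\mathbf 1}\ltimes\underline D\to\underline D$ and $\underline D\ltimes\underline{\mathbf 1}\to\underline D$, a club structure on $\underline D$ is a monoid structure on $\underline D$ in $(\underline{Cat},\ltimes,\underline{\mathbf 1})$: morphisms $\underline D\ltimes\underline D\to\underline D$ and $\underline{\mathbf 1}\to\underline D$ satisfying the associativity axiom and the two unit axioms as equalities of morphisms of $\underline{Cat}$. For a simplicial set $\mathcal S$, its category of simplices $S$ has the set of objects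 $\coprod_{n\ge0}\mathcal S_n$, and a morphism from $s_m\in\mathcal S_m$ to $s_n\in\mathcal S_n$ is a simplicial operator (a morphism $[m]\to[n]$ of $\Delta^{op}$) whose action $\mathcal S_m\to\mathcal S_n$ carries $s_m$ to $s_n$. The category of simplices of a bisimplicial set is defined likewise, with bisimplicial operators. Let $\underline{SSet}=(SSet,R)\in\underline{Cat}$, where $R(\mathcal S)=S$ and $R(f)$ is the induced functor. Proposition. There is a club structure on $\underline{SSet}$, with multiplication $(\Delta,\delta):\underline{SSet}\ltimes\underline{SSet}\to\underline{SSet}$ and unit $(I,\iota):\underline{\mathbf 1}\to\underline{SSet}$, such that: 1. For each object $(\mathcal S,\psi:S\to SSet)$ of $SSet\ltimes SSet$ there is a bisimplicial set $\mathbb T$ whose category of simplices is isomorphic, compatibly with the bigradings by dimension and the underlying pairs of simplicial operators, to $S\ltimes_\psi\underline{SSet}$, and $\Delta(\mathcal S,\psi)$ is isomorphic to the diagonal $n\mapsto\mathbb T_{n,n}$ of $\mathbb T$. Under these isomorphisms, $\delta_{(\mathcal S,\psi)}$ is the diagonal functor, which sends an $n$-simplex $t\in\mathbb T_{n,n}$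 to $t$ as a simplex of $\mathbb T$ of bidegree $(n,n)$, and a simplicial operator $\theta$ to $(\theta,\theta)$. 2. $I$ sends the object of $\mathbf 1$ to a one-point simplicial set. -/

import Mathlib

open CategoryTheory

universe w u

namespace ClubSSet

theorem app_eqToHom {C : Type*} {D : Type*} [Category C] [Category D] {F G : C ⥤ D} (α : F ⟶ G)
    {a b : C} (e : a = b) :
    eqToHom (congrArg F.obj e) ≫ α.app b = α.app a ≫ eqToHom (congrArg G.obj e) := by
  subst e; simp

theorem app_eqToHom_assoc {C : Type*} {D : Type*} [Category C] [Category D] {F G : C ⥤ D}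
    (α : F ⟶ G) {a b : C} (e : a = b) {Z : D} (u : G.obj b ⟶ Z) :
    eqToHom (congrArg F.obj e) ≫ α.app b ≫ u =
      α.app a ≫ eqToHom (congrArg G.obj e) ≫ u := by
  subst e; simp

theorem eqToHom_aux₀ {C : Type*} [Category C] {X Y Z W : C} (e₁ : X = Y) (e₂ : Y = Z) (e₃ : Z = W)
    (e₄ : X = W) : (eqToHom e₁ ≫ eqToHom e₂) ≫ eqToHom e₃ = eqToHom e₄ := by simp

theorem eqToHom_aux₁ {C : Type*} [Category C] {X Y Z W V U W' : C} (f : X ⟶ Y) (g : Y ⟶ Z)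
    (e₁ : Z = W) (e₂ : W = V) (e₃ : V = U) (e₄ : Z = W') (e₅ : W' = U) :
    ((f ≫ g ≫ eqToHom e₁) ≫ eqToHom e₂) ≫ eqToHom e₃ = f ≫ (g ≫ eqToHom e₄) ≫ eqToHom e₅ := by
  simp

theorem eqToHom_aux₂ {C : Type*} [Category C] {X Y Y' Z Z' W V : C} (f : X ⟶ Y) (g : Y ⟶ Z)
    (h : X ⟶ Y') (i : Y' ⟶ Z') (e₁ : Z = W) (e₂ : W = V) (e₃ : Z' = V) {e₄ : Z' = Z}
    (H : f ≫ g = h ≫ i ≫ eqToHom e₄) :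
    (f ≫ g ≫ eqToHom e₁) ≫ eqToHom e₂ = h ≫ i ≫ eqToHom e₃ := by
  subst e₁ e₂ e₃; simpa using H

theorem eqToHom_aux₃ {C : Type*} [Category C] {X Y Y' Z Z' : C} {f : X ⟶ Y} {g : Y ⟶ Z}
    {h : X ⟶ Y'} {i : Y' ⟶ Z'} {e₁ : Z' = Z} (H : f ≫ g = h ≫ i ≫ eqToHom e₁) (e₂ : Z = Z') :
    (f ≫ g) ≫ eqToHom e₂ = h ≫ i := by
  subst e₁; simpa using H

/-- An object of the category of small diagrams in `Cat`: a small category `D` together with a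
functor `R : D ⥤ Cat`. -/
structure Diagram where
  D : Type w
  [str : Category.{w} D]
  R : D ⥤ Cat.{w, w}

namespace Diagram

attribute [instance] str

/-- The functor `R(f) : R(d) ⥤ R(e)` -/
abbrev act (X : Diagram.{w}) {d e : X.D} (f : d ⟶ e) : X.R.obj d ⥤ X.R.obj e := (X.R.map f).toFunctor

theorem act_id (X : Diagram.{w}) (d : X.D) : X.act (𝟙 d) = 𝟭 _ :=
  congrArg Cat.Hom.toFunctor (X.R.map_id d)

theorem act_comp (X : Diagram.{w}) {d e c : X.D} (f : d ⟶ e) (g : e ⟶ c) :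
    X.act (f ≫ g) = X.act f ⋙ X.act g :=
  congrArg Cat.Hom.toFunctor (X.R.map_comp f g)

/-- A morphism of diagrams `(D, R) ⟶ (D', R')`: a functor `F : D ⥤ D'` and a natural
transformation `ρ : F ⋙ R' ⟶ R`. -/
structure Hom (X Y : Diagram.{w}) where
  F : X.D ⥤ Y.D
  ρ : F ⋙ Y.R ⟶ X.R

instance : Category Diagram.{w} where
  Hom := Hom
  id X := ⟨𝟭 X.D, 𝟙 X.R⟩
  comp f g := ⟨f.F ⋙ g.F, Functor.whiskerLeft f.F g.ρ ≫ f.ρ⟩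

variable {X Y Z : Diagram.{w}}

/-- The component `ρ_d : R'(F d) ⥤ R(d)` of a morphism of diagrams. -/
abbrev Hom.comp (g : X ⟶ Y) (d : X.D) : Y.R.obj (g.F.obj d) ⥤ X.R.obj d := (g.ρ.app d).toFunctor

theorem Hom.comp_naturality (g : X ⟶ Y) {d e : X.D} (f : d ⟶ e) :
    Y.act (g.F.map f) ⋙ Hom.comp g e = Hom.comp g d ⋙ X.act f :=
  congrArg Cat.Hom.toFunctor (g.ρ.naturality f)

/-- Objects of the parameterizing category `D ⋉ D'` of the semi-direct product: pairs
`(d, ψ)` with `d` an object of `D` and `ψ : R(d) ⥤ D'` a functor. -/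
structure Param (X Y : Diagram.{w}) where
  d : X.D
  ψ : X.R.obj d ⥤ Y.D

namespace Param

/-- Morphisms `(d₁, ψ₁) ⟶ (d₂, ψ₂)` of `D ⋉ D'`: pairs `(f, φ)` with `f : d₁ ⟶ d₂` and `φ` a natural
transformation `ψ₁ ⟶ R(f) ⋙ ψ₂`, given by its components. -/
structure Hom (p q : Param X Y) where
  f : p.d ⟶ q.d
  φ : ∀ a : X.R.obj p.d, p.ψ.obj a ⟶ q.ψ.obj ((X.act f).obj a)
  naturality : ∀ {a b : X.R.obj p.d} (α : a ⟶ b),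
    p.ψ.map α ≫ φ b = φ a ≫ q.ψ.map ((X.act f).map α)

theorem Hom.naturality_assoc {p q : Param X Y} (g : Hom p q) {a b : X.R.obj p.d} (α : a ⟶ b)
    {Z : Y.D} (u : q.ψ.obj ((X.act g.f).obj b) ⟶ Z) :
    p.ψ.map α ≫ g.φ b ≫ u = g.φ a ≫ q.ψ.map ((X.act g.f).map α) ≫ u := by
  rw [← Category.assoc, g.naturality, Category.assoc]

theorem Hom.ext' {p q : Param X Y} {g h : Hom p q} (hf : g.f = h.f)
    (hφ : ∀ a, g.φ a ≫ eqToHom (by rw [hf]) = h.φ a) : g = h := by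
  obtain ⟨g, γ, _⟩ := g
  obtain ⟨h, η, _⟩ := h
  obtain rfl : g = h := hf
  congr
  ext a
  simpa using hφ a

theorem Hom.φ_eqToHom {p q : Param X Y} (g : Hom p q) {a b : X.R.obj p.d} (e : a = b) :
    eqToHom (congrArg p.ψ.obj e) ≫ g.φ b =
      g.φ a ≫ eqToHom (congrArg (fun x => q.ψ.obj ((X.act g.f).obj x)) e) := by
  subst e; simp

theorem Hom.φ_eqToHom_assoc {p q : Param X Y} (g : Hom p q) {a b : X.R.obj p.d} (e : a = b)
    {Z : Y.D} (u : q.ψ.obj ((X.act g.f).obj b) ⟶ Z) :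
    eqToHom (congrArg p.ψ.obj e) ≫ g.φ b ≫ u =
      g.φ a ≫ eqToHom (congrArg (fun x => q.ψ.obj ((X.act g.f).obj x)) e) ≫ u := by
  subst e; simp

/-- Identities are `(𝟙, 𝟙)` and composition is `(f, φ) ≫ (h, χ) = (f ≫ h, a ↦ φ_a ≫ χ_{R(f) a})`;
the `eqToHom`s only identify `R(𝟙) a` with `a` and `R(f ≫ h) a` with `R(h) (R(f) a)`. -/
instance : Category (Param X Y) where
  Hom := Hom
  id p :=
    { f := 𝟙 p.d
      φ := fun a => eqToHom (by rw [X.act_id]; rfl)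
      naturality := fun {a b} α => by
        rw [Functor.congr_hom (X.act_id p.d) α]
        simp [eqToHom_map] }
  comp {p q r} g h :=
    { f := g.f ≫ h.f
      φ := fun a => g.φ a ≫ h.φ ((X.act g.f).obj a) ≫ eqToHom (by rw [X.act_comp]; rfl)
      naturality := fun {a b} α => by
        rw [Functor.congr_hom (X.act_comp g.f h.f) α]
        simp [eqToHom_map, Hom.naturality_assoc] }
  id_comp g := Hom.ext' (Category.id_comp _) fun a => by
    simp [← Hom.φ_eqToHom g (Functor.congr_obj (X.act_id _) a)]
  comp_id g := Hom.ext' (Category.comp_id _) fun a => by simp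
  assoc g h k := Hom.ext' (Category.assoc _ _ _) fun a => by
    simp [Hom.φ_eqToHom_assoc k (Functor.congr_obj (X.act_comp g.f h.f) a).symm]

theorem hom_ext {p q : Param X Y} {g h : p ⟶ q} (hf : g.f = h.f)
    (hφ : ∀ a, g.φ a ≫ eqToHom (by rw [hf]) = h.φ a) : g = h :=
  Hom.ext' hf hφ

@[simp] theorem id_f (p : Param X Y) : Hom.f (𝟙 p) = 𝟙 p.d := rfl
@[simp] theorem comp_f {p q r : Param X Y} (g : p ⟶ q) (h : q ⟶ r) :
    (g ≫ h).f = g.f ≫ h.f := rfl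
@[simp] theorem id_φ (p : Param X Y) (a : X.R.obj p.d) :
    Hom.φ (𝟙 p) a = eqToHom (by rw [id_f, X.act_id]; rfl) := rfl
@[simp] theorem comp_φ {p q r : Param X Y} (g : p ⟶ q) (h : q ⟶ r) (a : X.R.obj p.d) :
    (g ≫ h).φ a = g.φ a ≫ h.φ ((X.act g.f).obj a) ≫
      eqToHom (by rw [comp_f, X.act_comp]; rfl) := rfl

@[simp] theorem eqToHom_f {p q : Param X Y} (h : p = q) :
    (eqToHom h).f = eqToHom (congrArg d h) := by subst h; rfl
theorem eqToHom_φ_aux {p q : Param X Y} (h : p = q) (a : X.R.obj p.d) :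
    p.ψ.obj a = q.ψ.obj ((X.act (eqToHom h).f).obj a) := by
  subst h; exact congrArg p.ψ.obj (Functor.congr_obj (X.act_id p.d) a).symm
@[simp] theorem eqToHom_φ {p q : Param X Y} (h : p = q) (a : X.R.obj p.d) :
    (eqToHom h).φ a = eqToHom (eqToHom_φ_aux h a) := by
  subst h; rfl

/-- The underlying natural transformation. -/
def Hom.nat {p q : Param X Y} (g : p ⟶ q) : p.ψ ⟶ X.act g.f ⋙ q.ψ where
  app := g.φ
  naturality _ _ α := g.naturality α

end Param

/-- For a functor `P : A ⥤ Cat`, the category of pairs `(a, b)` with `a` in `A`, `b` in `P(a)`.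
For `P = ψ ⋙ R'` this is the category `R(d) ⋉_ψ D'`. -/
structure Gr {A : Type w} [Category.{w} A] (P : A ⥤ Cat.{w, w}) where
  base : A
  fiber : P.obj base

namespace Gr
variable {A B C : Type w} [Category.{w} A] [Category.{w} B] [Category.{w} C] {P : A ⥤ Cat.{w, w}}
    {Q : B ⥤ Cat.{w, w}} {S : C ⥤ Cat.{w, w}}

/-- Morphisms `(a₁, b₁) ⟶ (a₂, b₂)`: pairs `α : a₁ ⟶ a₂`, `β : P(α)(b₁) ⟶ b₂`. -/
structure Hom (x y : Gr P) where
  base : x.base ⟶ y.base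
  fiber : (P.map base).toFunctor.obj x.fiber ⟶ y.fiber

theorem Hom.ext' {x y : Gr P} {f g : Hom x y} (h : f.base = g.base)
    (hf : eqToHom (by rw [h]) ≫ f.fiber = g.fiber) : f = g := by
  obtain ⟨f, φ⟩ := f
  obtain ⟨g, γ⟩ := g
  obtain rfl : f = g := h
  congr
  simpa using hf

theorem map_id_obj (P : A ⥤ Cat.{w, w}) (a : A) (b : P.obj a) :
    (P.map (𝟙 a)).toFunctor.obj b = b := by simp

theorem map_comp_obj (P : A ⥤ Cat.{w, w}) {a a' a'' : A} (f : a ⟶ a') (g : a' ⟶ a'')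
    (b : P.obj a) : (P.map (f ≫ g)).toFunctor.obj b =
      (P.map g).toFunctor.obj ((P.map f).toFunctor.obj b) := by simp

theorem map_id_map (P : A ⥤ Cat.{w, w}) (a : A) {b b' : P.obj a} (β : b ⟶ b') :
    (P.map (𝟙 a)).toFunctor.map β =
      eqToHom (map_id_obj P a b) ≫ β ≫ eqToHom (map_id_obj P a b').symm :=
  Functor.congr_hom (congrArg Cat.Hom.toFunctor (P.map_id a)) β

theorem map_comp_map (P : A ⥤ Cat.{w, w}) {a a' a'' : A} (f : a ⟶ a') (g : a' ⟶ a'')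
    {b b' : P.obj a} (β : b ⟶ b') : (P.map (f ≫ g)).toFunctor.map β =
      eqToHom (map_comp_obj P f g b) ≫ (P.map g).toFunctor.map ((P.map f).toFunctor.map β) ≫
        eqToHom (map_comp_obj P f g b').symm :=
  Functor.congr_hom (congrArg Cat.Hom.toFunctor (P.map_comp f g)) β

/-- The composite of `(α₁, β₁)` and `(α₂, β₂)` is `(α₁ ≫ α₂, P(α₂)(β₁) ≫ β₂)`; the `eqToHom`s only
identify `P(𝟙) b` with `b` and `P(α₁ ≫ α₂) b` with `P(α₂) (P(α₁) b)`. -/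
@[reducible]
instance : Category (Gr P) where
  Hom := Hom
  id x := ⟨𝟙 x.base, eqToHom (map_id_obj P x.base x.fiber)⟩
  comp f g := ⟨f.base ≫ g.base,
    eqToHom (map_comp_obj P f.base g.base _) ≫ (P.map g.base).toFunctor.map f.fiber ≫ g.fiber⟩
  id_comp f := Hom.ext' (Category.id_comp _) (by simp [eqToHom_map])
  comp_id f := Hom.ext' (Category.comp_id _) (by simp [map_id_map])
  assoc f g h := Hom.ext' (Category.assoc _ _ _) (by simp [map_comp_map, eqToHom_map])

theorem hom_ext {x y : Gr P} {f g : x ⟶ y} (h : f.base = g.base)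
    (hf : eqToHom (by rw [h]) ≫ f.fiber = g.fiber) : f = g := Hom.ext' h hf

@[simp] theorem id_base (x : Gr P) : Hom.base (𝟙 x) = 𝟙 x.base := rfl
@[simp] theorem id_fiber (x : Gr P) :
    Hom.fiber (𝟙 x) = eqToHom (map_id_obj P x.base x.fiber) := rfl
@[simp] theorem comp_base {x y z : Gr P} (f : x ⟶ y) (g : y ⟶ z) :
    (f ≫ g).base = f.base ≫ g.base := rfl
@[simp] theorem comp_fiber {x y z : Gr P} (f : x ⟶ y) (g : y ⟶ z) :
    (f ≫ g).fiber = eqToHom (map_comp_obj P f.base g.base _) ≫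
      (P.map g.base).toFunctor.map f.fiber ≫ g.fiber := rfl
@[simp] theorem eqToHom_base {x y : Gr P} (h : x = y) :
    (eqToHom h).base = eqToHom (congrArg base h) := by subst h; rfl
theorem eqToHom_fiber_aux {x y : Gr P} (h : x = y) :
    (P.map (eqToHom h).base).toFunctor.obj x.fiber = y.fiber := by subst h; simp
@[simp] theorem eqToHom_fiber {x y : Gr P} (h : x = y) :
    (eqToHom h).fiber = eqToHom (eqToHom_fiber_aux h) := by subst h; rfl

theorem nat_obj {F G : A ⥤ Cat.{w, w}} (η : F ⟶ G) {x y : A} (f : x ⟶ y) (b : F.obj x) :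
    (G.map f).toFunctor.obj ((η.app x).toFunctor.obj b) =
      (η.app y).toFunctor.obj ((F.map f).toFunctor.obj b) :=
  (Functor.congr_obj (congrArg Cat.Hom.toFunctor (η.naturality f)) b).symm

theorem nat_map {F G : A ⥤ Cat.{w, w}} (η : F ⟶ G) {x y : A} (f : x ⟶ y) {b c : F.obj x}
    (β : b ⟶ c) :
    (η.app y).toFunctor.map ((F.map f).toFunctor.map β) = eqToHom (nat_obj η f b).symm ≫
    (G.map f).toFunctor.map ((η.app x).toFunctor.map β) ≫ eqToHom (nat_obj η f c) :=
  (Functor.congr_hom (congrArg Cat.Hom.toFunctor (η.naturality f)) β)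

/-- The functor `(a, b) ↦ (G a, η_a b)`, `(α, β) ↦ (G α, η β)`. -/
@[reducible]
def map (G : A ⥤ B) (η : P ⟶ G ⋙ Q) : Gr P ⥤ Gr Q where
  obj x := ⟨G.obj x.base, (η.app x.base).toFunctor.obj x.fiber⟩
  map {x y} f := ⟨G.map f.base, eqToHom (nat_obj η f.base x.fiber) ≫
    (η.app y.base).toFunctor.map f.fiber⟩
  map_id x := hom_ext (G.map_id _) (by simp [eqToHom_map])
  map_comp {x y z} f g := hom_ext (G.map_comp _ _) (by simp [eqToHom_map, nat_map])

theorem map_congr {G G' : A ⥤ B} {η : P ⟶ G ⋙ Q} {η' : P ⟶ G' ⋙ Q} (h : G = G')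
    (hη : ∀ a, η.app a ≫ eqToHom (congrArg (fun K : A ⥤ B => Q.obj (K.obj a)) h) = η'.app a) :
    map G η = map G' η' := by
  subst h
  congr 1
  ext1; ext1 a
  simpa using hη a

theorem map_id (P : A ⥤ Cat.{w, w}) : map (Q := P) (𝟭 A) (𝟙 P) = 𝟭 _ := by
  refine Functor.hext (fun _ => rfl) fun b c β => heq_of_eq ?_
  exact hom_ext rfl (by simp)

theorem map_comp (G : A ⥤ B) (H : B ⥤ C) (η : P ⟶ G ⋙ Q) (θ : Q ⟶ H ⋙ S) :
    map G η ⋙ map H θ = map (G ⋙ H) (η ≫ Functor.whiskerLeft G θ) := by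
  refine Functor.hext (fun _ => rfl) fun b c β => heq_of_eq ?_
  exact hom_ext rfl (by simp [eqToHom_map])

/-- The inclusion of the fibre, `b ↦ (a, b)`. -/
@[reducible]
def ι (P : A ⥤ Cat.{w, w}) (a : A) : P.obj a ⥤ Gr P where
  obj b := ⟨a, b⟩
  map β := ⟨𝟙 a, eqToHom (map_id_obj P a _) ≫ β⟩
  map_id b := hom_ext rfl (by simp)
  map_comp β γ := hom_ext (by simp) (by simp [map_id_map])

theorem ι_map (G : A ⥤ B) (η : P ⟶ G ⋙ Q) (a : A) :
    ι P a ⋙ map G η = (η.app a).toFunctor ⋙ ι Q (G.obj a) := by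
  refine Functor.hext (fun _ => rfl) fun b c β => heq_of_eq ?_
  exact hom_ext (by simp) (by simp [eqToHom_map])

/-- The morphism `(α, 𝟙) : (a, b) ⟶ (a', P(α) b)`. -/
@[reducible]
def push (P : A ⥤ Cat.{w, w}) {a a' : A} (α : a ⟶ a') (b : P.obj a) :
    (⟨a, b⟩ : Gr P) ⟶ ⟨a', (P.map α).toFunctor.obj b⟩ :=
  ⟨α, 𝟙 _⟩

@[simp] theorem push_base (P : A ⥤ Cat.{w, w}) {a a' : A} (α : a ⟶ a') (b : P.obj a) :
    (push P α b).base = α := rfl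
@[simp] theorem push_fiber (P : A ⥤ Cat.{w, w}) {a a' : A} (α : a ⟶ a') (b : P.obj a) :
    (push P α b).fiber = 𝟙 ((P.map α).toFunctor.obj b) := rfl

theorem push_naturality (P : A ⥤ Cat.{w, w}) {a a' : A} (α : a ⟶ a') {b c : P.obj a} (β : b ⟶ c) :
    (ι P a).map β ≫ push P α c = push P α b ≫ (ι P a').map ((P.map α).toFunctor.map β) :=
  hom_ext (by simp) (by simp [eqToHom_map, map_id_map])

theorem map_map_ι (G : A ⥤ B) (η : P ⟶ G ⋙ Q) (a : A) {b c : P.obj a} (β : b ⟶ c) :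
    (map G η).map ((ι P a).map β) = (ι Q (G.obj a)).map ((η.app a).toFunctor.map β) :=
  hom_ext (by simp) (by simp [eqToHom_map])

theorem map_push (G : A ⥤ B) (η : P ⟶ G ⋙ Q) {a a' : A} (α : a ⟶ a') (b : P.obj a) :
    (map G η).map (push P α b) =
      push Q (G.map α) ((η.app a).toFunctor.obj b) ≫
        eqToHom (congrArg (mk (G.obj a')) (nat_obj η α b)) :=
  hom_ext (by simp) (by simp)

theorem push_id (P : A ⥤ Cat.{w, w}) (a : A) (b : P.obj a) :
    push P (𝟙 a) b = eqToHom (congrArg (mk a) (map_id_obj P a b).symm) :=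
  hom_ext (by simp) (by simp)

theorem push_comp (P : A ⥤ Cat.{w, w}) {a a' a'' : A} (α : a ⟶ a') (α' : a' ⟶ a'') (b : P.obj a) :
    push P (α ≫ α') b = push P α b ≫ push P α' _ ≫
        eqToHom (congrArg (mk a'') (map_comp_obj P α α' b).symm) :=
  hom_ext (by simp) (by simp)

/-- Every morphism factors as a push-forward followed by a morphism in a fibre. -/
theorem fac {x y : Gr P} (f : x ⟶ y) :
    push P f.base x.fiber ≫ (ι P y.base).map f.fiber = f :=
  hom_ext (by simp) (by simp)

theorem fac_obj {T : A ⥤ Cat.{w, w}} (S : Gr T ⥤ Cat.{w, w}) {x y : Gr T} (f : x ⟶ y)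
    (c : S.obj x) : (S.map f).toFunctor.obj c =
      (S.map ((ι T y.base).map f.fiber)).toFunctor.obj
        ((S.map (push T f.base x.fiber)).toFunctor.obj c) :=
  (congrArg (fun g => (S.map g).toFunctor.obj c) (fac f).symm).trans
    (map_comp_obj S _ _ c)

theorem fac_map {T : A ⥤ Cat.{w, w}} (S : Gr T ⥤ Cat.{w, w}) {x y : Gr T} (f : x ⟶ y)
    {c c' : S.obj x} (γ : c ⟶ c') : (S.map f).toFunctor.map γ =
      eqToHom (fac_obj S f c) ≫ (S.map ((ι T y.base).map f.fiber)).toFunctor.map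
        ((S.map (push T f.base x.fiber)).toFunctor.map γ) ≫ eqToHom (fac_obj S f c').symm := by
  have h := Functor.congr_hom (congrArg (fun g => (S.map g).toFunctor) (fac f).symm) γ
  dsimp only at h
  rw [h, map_comp_map]
  simp

/-- The fibrewise construction `a ↦ {(b, c) : b in T(a), c in S(a, b)}`, as a functor of `a`. -/
@[reducible]
def sum (T : A ⥤ Cat.{w, w}) (S : Gr T ⥤ Cat.{w, w}) : A ⥤ Cat.{w, w} where
  obj a := ⟨Gr (ι T a ⋙ S), inferInstance⟩
  map {a a'} α := Functor.toCatHom (map (P := ι T a ⋙ S) (Q := ι T a' ⋙ S) (T.map α).toFunctor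
    { app := fun b => S.map (push T α b)
      naturality := fun b c β => by
        have := congrArg S.map (push_naturality T α β)
        simpa using this })
  map_id a := by
    apply Cat.ext
    refine (map_congr (G' := 𝟭 _) (η' := 𝟙 (ι T a ⋙ S))
      (congrArg Cat.Hom.toFunctor (T.map_id a)) fun b => ?_).trans (map_id (ι T a ⋙ S))
    dsimp only
    rw [push_id]
    simp [eqToHom_map]
  map_comp {a a' a''} α α' := by
    apply Cat.ext
    refine Eq.trans (map_congr (Q := ι T a'' ⋙ S)
      (congrArg Cat.Hom.toFunctor (T.map_comp α α')) fun b => ?_) (map_comp _ _ _ _).symm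
    dsimp only
    rw [push_comp]
    simp [eqToHom_map]

/-- The rebracketing functor `(a, (b, c)) ↦ ((a, b), c)`. -/
@[reducible]
def sumAssoc (T : A ⥤ Cat.{w, w}) (S : Gr T ⥤ Cat.{w, w}) : Gr (sum T S) ⥤ Gr S where
  obj x := ⟨⟨x.base, x.fiber.base⟩, x.fiber.fiber⟩
  map {x y} k := ⟨⟨k.base, k.fiber.base⟩, eqToHom (fac_obj S _ _) ≫ k.fiber.fiber⟩
  map_id x := by
    refine hom_ext (hom_ext rfl (by simp)) ?_
    simp
  map_comp k l := by
    refine hom_ext (hom_ext rfl (by simp)) ?_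
    simp only [comp_fiber, comp_base, Functor.map_comp, eqToHom_map, Category.assoc]
    rw [fac_map]
    simp [eqToHom_map]

/-- Functoriality of the fibrewise construction. -/
@[reducible]
def sumMap {T : A ⥤ Cat.{w, w}} {S : Gr T ⥤ Cat.{w, w}} {T' : B ⥤ Cat.{w, w}}
    {S' : Gr T' ⥤ Cat.{w, w}} (G : A ⥤ B) (η : T ⟶ G ⋙ T') (θ : S ⟶ map G η ⋙ S') :
    sum T S ⟶ G ⋙ sum T' S' where
  app a := Functor.toCatHom (map (P := ι T a ⋙ S) (Q := ι T' (G.obj a) ⋙ S') (η.app a).toFunctor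
    { app := fun b => θ.app ⟨a, b⟩
      naturality := fun b c β => by
        have h := θ.naturality ((ι T a).map β)
        rw [Functor.comp_map, map_map_ι] at h
        exact h })
  naturality a a' α := by
    apply Cat.ext
    refine (map_comp _ _ _ _).trans (Eq.trans ?_ (map_comp _ _ _ _).symm)
    refine map_congr (congrArg Cat.Hom.toFunctor (η.naturality α)) fun b => ?_
    have h := θ.naturality (push T α b)
    rw [Functor.comp_map, map_push, Functor.map_comp, eqToHom_map] at h
    exact eqToHom_aux₃ h _

theorem sumAssoc_map {T : A ⥤ Cat.{w, w}} {S : Gr T ⥤ Cat.{w, w}} {T' : B ⥤ Cat.{w, w}}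
    {S' : Gr T' ⥤ Cat.{w, w}} (G : A ⥤ B) (η : T ⟶ G ⋙ T') (θ : S ⟶ map G η ⋙ S') :
    map G (sumMap G η θ) ⋙ sumAssoc T' S' = sumAssoc T S ⋙ map (map G η) θ := by
  refine Functor.hext (fun _ => rfl) fun x y f => heq_of_eq ?_
  refine Gr.hom_ext (Gr.hom_ext rfl ?_) ?_
  · simp
  · simp [eqToHom_map]

end Gr

/-- The functor `R ⋉ R' : D ⋉ D' ⥤ Cat`, `(d, ψ) ↦ R(d) ⋉_ψ D'`; a morphism `(f, φ)` is sent to the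
functor `(a, b) ↦ (R(f) a, R'(φ_a) b)`. -/
@[reducible]
def tensorR (X Y : Diagram.{w}) : Param X Y ⥤ Cat.{w, w} where
  obj p := ⟨Gr (p.ψ ⋙ Y.R), inferInstance⟩
  map {_ q} g := (Gr.map (Q := q.ψ ⋙ Y.R) (X.act g.f)
    (Functor.whiskerRight (Param.Hom.nat g) Y.R)).toCatHom
  map_id p := by
    apply Cat.ext
    refine (Gr.map_congr (G' := 𝟭 _) (η' := 𝟙 (p.ψ ⋙ Y.R)) (X.act_id _) ?_).trans
      (Gr.map_id (p.ψ ⋙ Y.R))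
    intro a
    simp [eqToHom_map, Param.Hom.nat]
  map_comp {_ _ r} g h := by
    apply Cat.ext
    refine Eq.trans (Gr.map_congr (Q := r.ψ ⋙ Y.R) (X.act_comp g.f h.f) ?_)
      (Gr.map_comp _ _ _ _).symm
    intro a
    simp [eqToHom_map, Param.Hom.nat]

/-- The semi-direct product `X ⋉ Y = (D ⋉ D', R ⋉ R')` of diagrams. -/
@[reducible]
def tensor (X Y : Diagram.{w}) : Diagram.{w} where
  D := Param X Y
  R := tensorR X Y

theorem Hom.comp_naturality_obj (g : X ⟶ Y) {d e : X.D} (f : d ⟶ e) (a : Y.R.obj (g.F.obj d)) :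
    (Hom.comp g e).obj ((Y.act (g.F.map f)).obj a) = (X.act f).obj ((Hom.comp g d).obj a) :=
  Functor.congr_obj (Hom.comp_naturality g f) a

variable {X' Y' : Diagram.{w}}

/-- The functor `(d, ψ) ↦ (F d, ρ_d ⋙ ψ ⋙ F')` underlying `(F, ρ) ⋉ (F', ρ')`. -/
@[reducible]
def tensorHomF (g : X ⟶ X') (h : Y ⟶ Y') : Param X Y ⥤ Param X' Y' where
  obj p := ⟨g.F.obj p.d, Hom.comp g p.d ⋙ p.ψ ⋙ h.F⟩
  map {p q} k :=
    { f := g.F.map k.f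
      φ := fun a => h.F.map (k.φ ((Hom.comp g p.d).obj a) ≫
        eqToHom (congrArg q.ψ.obj (Hom.comp_naturality_obj g k.f a).symm))
      naturality := fun {a b} α => by
        have := Functor.congr_hom (Hom.comp_naturality g k.f) α
        simp only [Functor.comp_map] at this ⊢
        rw [← Functor.map_comp, ← Functor.map_comp, this]
        simp [eqToHom_map, Param.Hom.naturality_assoc] }
  map_id p := by
    refine Param.hom_ext (by simp) fun a => ?_
    simp [eqToHom_map]
  map_comp {p q r} k l := by
    refine Param.hom_ext (by simp) fun a => ?_
    have e := Hom.comp_naturality_obj g k.f a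
    have := fun {Z} (u : _ ⟶ Z) => app_eqToHom_assoc (Functor.whiskerRight (Param.Hom.nat l) h.F)
      e.symm u
    simp only [Param.Hom.nat, Functor.whiskerRight_app, Functor.comp_obj] at this
    simp [eqToHom_map, this]

/-- The functors `R₁(F d) ⋉ Y' ⥤ R(d) ⋉_ψ Y`, `(a, b) ↦ (ρ_d a, ρ' b)`. -/
def tensorHomρ (g : X ⟶ X') (h : Y ⟶ Y') :
    tensorHomF g h ⋙ tensorR X' Y' ⟶ tensorR X Y where
  app p := (Gr.map (P := (Hom.comp g p.d ⋙ p.ψ ⋙ h.F) ⋙ Y'.R) (Q := p.ψ ⋙ Y.R) (Hom.comp g p.d)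
      (Functor.whiskerLeft (Hom.comp g p.d ⋙ p.ψ) h.ρ)).toCatHom
  naturality p q k := by
    apply Cat.ext
    refine (Gr.map_comp _ _ _ _).trans (Eq.trans ?_ (Gr.map_comp _ _ _ _).symm)
    refine Gr.map_congr (Hom.comp_naturality g k.f) fun (a : X'.R.obj (g.F.obj p.d)) => ?_
    have h1 := fun {Z} (u : _ ⟶ Z) => app_eqToHom_assoc (Functor.whiskerLeft q.ψ h.ρ)
      (Hom.comp_naturality_obj g k.f a).symm u
    have h2 := h.ρ.naturality (k.φ ((Hom.comp g p.d).obj a))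
    simp only [Functor.whiskerLeft_app, Functor.comp_obj, Functor.comp_map] at h1 h2
    have key : (Y'.R.map (h.F.map (k.φ ((Hom.comp g p.d).obj a) ≫
        eqToHom (congrArg q.ψ.obj (Hom.comp_naturality_obj g k.f a).symm))) ≫
      h.ρ.app (q.ψ.obj ((Hom.comp g q.d).obj ((X'.act (g.F.map k.f)).obj a)))) ≫
      eqToHom (congrArg (fun x => Y.R.obj (q.ψ.obj x)) (Hom.comp_naturality_obj g k.f a)) =
      h.ρ.app (p.ψ.obj ((Hom.comp g p.d).obj a)) ≫ Y.R.map (k.φ ((Hom.comp g p.d).obj a)) := by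
      simp only [Functor.map_comp, eqToHom_map, Category.assoc]
      rw [h1, eqToHom_trans, eqToHom_refl, Category.comp_id, h2]
    exact key

/-- The action of `⋉` on morphisms of diagrams. -/
def tensorHom (g : X ⟶ X') (h : Y ⟶ Y') : tensor X Y ⟶ tensor X' Y' where
  F := tensorHomF g h
  ρ := tensorHomρ g h

/-- The unit diagram: the discrete category on one object, mapped to itself in `Cat`. -/
abbrev unit : Diagram.{w} where
  D := Discrete PUnit.{w + 1}
  R := (Functor.const _).obj ⟨Discrete PUnit.{w + 1}, inferInstance⟩

/-- The functor `(⋆, ψ) ↦ ψ(⋆)`. -/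
def leftUnitorF (X : Diagram.{w}) : Param unit X ⥤ X.D where
  obj p := p.ψ.obj ⟨⟨⟩⟩
  map k := k.φ ⟨⟨⟩⟩
  map_id p := Param.id_φ p _
  map_comp k l := (Param.comp_φ k l _).trans
    (congrArg (k.φ _ ≫ ·) (Category.comp_id _))

/-- The functors `R(ψ(⋆)) ⥤ 1 ⋉_ψ X`, `b ↦ (⋆, b)`. -/
def leftUnitorρ (X : Diagram.{w}) : leftUnitorF X ⋙ X.R ⟶ tensorR unit X where
  app p := (Gr.ι (p.ψ ⋙ X.R) ⟨⟨⟩⟩).toCatHom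
  naturality p q k := by
    apply Cat.ext
    exact (Gr.ι_map (P := p.ψ ⋙ X.R) (Q := q.ψ ⋙ X.R) (unit.act k.f)
      (Functor.whiskerRight (Param.Hom.nat k) X.R) ⟨⟨⟩⟩).symm

/-- The canonical morphism `1 ⋉ X ⟶ X`. -/
def leftUnitor (X : Diagram.{w}) : tensor unit X ⟶ X where
  F := leftUnitorF X
  ρ := leftUnitorρ X

/-- The canonical morphism `X ⋉ 1 ⟶ X`: `(d, ψ) ↦ d`, with components `R(d) ⥤ R(d) ⋉ 1`,
`a ↦ (a, ⋆)`. -/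
def rightUnitor (X : Diagram.{w}) : tensor X unit ⟶ X where
  F :=
    { obj p := p.d
      map k := k.f
      map_id _ := rfl
      map_comp _ _ := rfl }
  ρ :=
    { app _ := Functor.toCatHom
        { obj a := ⟨a, ⟨⟨⟩⟩⟩
          map f := ⟨f, 𝟙 _⟩
          map_id _ := rfl
          map_comp _ _ := rfl }
      naturality _ _ _ := rfl }

/-- The functor `z ↦ (P z, a ↦ Q (z, a))`. -/
@[reducible]
def curryF {X Y : Diagram.{w}} {Z : Type w} [Category.{w} Z] (P : Z ⥤ X.D)
    (Q : Gr (P ⋙ X.R) ⥤ Y.D) : Z ⥤ Param X Y where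
  obj z := ⟨P.obj z, Gr.ι (P ⋙ X.R) z ⋙ Q⟩
  map k :=
    { f := P.map k
      φ := fun a => Q.map (Gr.push (P ⋙ X.R) k a)
      naturality := fun α => by
        simpa using congrArg Q.map (Gr.push_naturality (P ⋙ X.R) k α) }
  map_id z := by
    refine Param.hom_ext (by simp) fun a => ?_
    dsimp only
    rw [Gr.push_id]
    simp [eqToHom_map]
  map_comp k l := by
    refine Param.hom_ext (by simp) fun a => ?_
    dsimp only
    rw [Gr.push_comp]
    simp [eqToHom_map]

/-- The functor `((d, ψ), χ) ↦ (d, a ↦ (ψ a, b ↦ χ (a, b)))`. -/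
@[reducible]
def assocF (X Y Z : Diagram.{w}) : Param (tensor X Y) Z ⥤ Param X (tensor Y Z) where
  obj p := ⟨p.d.d, curryF (X := Y) p.d.ψ p.ψ⟩
  map {p q} k :=
    { f := k.f.f
      φ := fun a =>
        { f := k.f.φ a
          φ := fun b => k.φ ⟨a, b⟩
          naturality := fun {b c} β =>
            (k.naturality ((Gr.ι (p.d.ψ ⋙ Y.R) a).map β)).trans
            (congrArg (fun t => k.φ _ ≫ q.ψ.map t) (Gr.map_map_ι _ _ _ _)) }
      naturality := fun {a b} α => by
        refine Param.hom_ext (k.f.naturality α) fun c => ?_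
        have := k.naturality (Gr.push (p.d.ψ ⋙ Y.R) α c)
        have h2 := Gr.map_push (P := p.d.ψ ⋙ Y.R) (Q := q.d.ψ ⋙ Y.R) (X.act k.f.f)
          (Functor.whiskerRight (Param.Hom.nat k.f) Y.R) α c
        have h3 := this.trans (congrArg (fun t => k.φ ⟨a, c⟩ ≫ q.ψ.map t) h2)
        dsimp only at h3
        rw [Functor.map_comp, eqToHom_map] at h3
        simp only [Param.comp_φ]
        exact eqToHom_aux₂ _ _ _ _ _ _ _ h3 }
  map_id p := by
    refine Param.hom_ext (by simp) fun a => ?_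
    refine Param.hom_ext (by simp) fun b => ?_
    simp
    exact eqToHom_aux₀ _ _ _ _
  map_comp k l := by
    refine Param.hom_ext (by simp) fun a => ?_
    refine Param.hom_ext (by simp) fun b => ?_
    simp
    exact eqToHom_aux₁ _ _ _ _ _ _ _

/-- The functors `(a, (b, c)) ↦ ((a, b), c)`. -/
def assocρ (X Y Z : Diagram.{w}) :
    assocF X Y Z ⋙ tensorR X (tensor Y Z) ⟶ tensorR (tensor X Y) Z where
  app p := (Gr.sumAssoc (p.d.ψ ⋙ Y.R) (p.ψ ⋙ Z.R)).toCatHom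
  naturality p q k := by
    apply Cat.ext
    exact Gr.sumAssoc_map (T := p.d.ψ ⋙ Y.R) (S := p.ψ ⋙ Z.R) (T' := q.d.ψ ⋙ Y.R)
      (S' := q.ψ ⋙ Z.R) (X.act k.f.f) (Functor.whiskerRight (Param.Hom.nat k.f) Y.R)
      (Functor.whiskerRight (Param.Hom.nat k) Z.R)

/-- The canonical morphism `(X ⋉ Y) ⋉ Z ⟶ X ⋉ (Y ⋉ Z)`. -/
def assoc (X Y Z : Diagram.{w}) : tensor (tensor X Y) Z ⟶ tensor X (tensor Y Z) where
  F := assocF X Y Z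
  ρ := assocρ X Y Z

end Diagram

open Diagram in
/-- A monoid structure on the diagram `X` with respect to `⋉` and the unit diagram, that is, a club
structure on `X`. -/
structure Club (X : Diagram.{w}) where
  mul : tensor X X ⟶ X
  one : unit ⟶ X
  one_mul : tensorHom one (𝟙 X) ≫ mul = leftUnitor X
  mul_one : tensorHom (𝟙 X) one ≫ mul = rightUnitor X
  mul_assoc : tensorHom mul (𝟙 X) ≫ mul = assoc X X X ≫ tensorHom (𝟙 X) mul ≫ mul

/-- The objects of the category of sets in a universe: the sets of the universe `ZFSet.{u}`. -/
structure USet : Type (u + 1) where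
  carrier : ZFSet.{u}

/-- The elements of a set of the universe. -/
abbrev USet.Elem (A : USet.{u}) : Type (u + 1) := {y : ZFSet.{u} // y ∈ A.carrier}

/-- The category of sets in the universe: morphisms are maps. -/
instance : Category USet.{u} where
  Hom A B := A.Elem → B.Elem
  id _ := fun a => a
  comp f g := fun a => g (f a)

section Elements

variable {C D : Type} [Category.{0} C] [Category.{0} D]

/-- Objects of the category of elements of `F : C ⥤ USet`: pairs of an object `c` of `C` and an
element of `F(c)`. For a simplicial set `F` these are the simplices of `F`. -/
structure El (F : C ⥤ USet.{u}) : Type (u + 1) where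
  base : C
  pt : (F.obj base).Elem

namespace El

/-- Morphisms of the category of elements: morphisms `opr` of `C` such that `F(opr)` carries the first
element to the second. For a simplicial set, `opr` is a simplicial operator. -/
structure Hom {F : C ⥤ USet.{u}} (x y : El F) : Type (u + 1) where
  opr : x.base ⟶ y.base
  map_pt : F.map opr x.pt = y.pt

theorem Hom.ext' {F : C ⥤ USet.{u}} {x y : El F} {f g : Hom x y} (h : f.opr = g.opr) : f = g := by
  cases f; cases g; cases h; rfl

instance (F : C ⥤ USet.{u}) : Category.{u + 1} (El F) where
  Hom := Hom
  id x := ⟨𝟙 x.base, congrFun (F.map_id x.base) x.pt⟩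
  comp f g := ⟨f.opr ≫ g.opr,
    (congrFun (F.map_comp f.opr g.opr) _).trans ((congrArg (F.map g.opr) f.map_pt).trans g.map_pt)⟩
  id_comp _ := Hom.ext' (Category.id_comp _)
  comp_id _ := Hom.ext' (Category.comp_id _)
  assoc _ _ _ := Hom.ext' (Category.assoc _ _ _)

theorem hom_ext {F : C ⥤ USet.{u}} {x y : El F} {f g : x ⟶ y} (h : f.opr = g.opr) : f = g :=
  Hom.ext' h

@[simp] theorem id_opr {F : C ⥤ USet.{u}} (x : El F) : Hom.opr (𝟙 x) = 𝟙 x.base := rfl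

@[simp] theorem comp_opr {F : C ⥤ USet.{u}} {x y z : El F} (f : x ⟶ y) (g : y ⟶ z) :
    (f ≫ g).opr = f.opr ≫ g.opr := rfl

@[simp] theorem eqToHom_opr {F : C ⥤ USet.{u}} {x y : El F} (h : x = y) :
    (eqToHom h).opr = eqToHom (congrArg base h) := by
  subst h; rfl

/-- The grading: the projection of the category of elements to `C`. -/
def proj (F : C ⥤ USet.{u}) : El F ⥤ C where
  obj x := x.base
  map f := f.opr

/-- The functor between categories of elements induced by a natural transformation. -/
def mapEl {F G : C ⥤ USet.{u}} (η : F ⟶ G) : El F ⥤ El G where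
  obj x := ⟨x.base, η.app x.base x.pt⟩
  map {x y} f := ⟨f.opr, (congrFun (η.naturality f.opr) x.pt).symm.trans
    (congrArg (η.app y.base) f.map_pt)⟩

/-- The functor `(c, t) ↦ (G c, t)` from the category of elements of `G ⋙ T` to that of `T`. -/
def pre (G : C ⥤ D) (T : D ⥤ USet.{u}) : El (G ⋙ T) ⥤ El T where
  obj x := ⟨G.obj x.base, x.pt⟩
  map f := ⟨G.map f.opr, f.map_pt⟩
  map_id _ := Hom.ext' (G.map_id _)
  map_comp _ _ := Hom.ext' (G.map_comp _ _)

end El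

/-- The functor sending `F : C ⥤ USet` to its category of elements. -/
def elR (C : Type) [Category.{0} C] : (C ⥤ USet.{u}) ⥤ Cat.{u + 1, u + 1} where
  obj F := ⟨El F, inferInstance⟩
  map η := (El.mapEl η).toCatHom
  map_id _ := rfl
  map_comp _ _ := rfl

end Elements

/-- Simplicial sets (in the given universe). -/
abbrev SSetU : Type (u + 1) := SimplexCategoryᵒᵖ ⥤ USet.{u}

/-- Bisimplicial sets (in the given universe). -/
abbrev BiSSetU : Type (u + 1) := (SimplexCategoryᵒᵖ × SimplexCategoryᵒᵖ) ⥤ USet.{u}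

/-- The diagram of simplicial sets: the category of simplicial sets, each simplicial set being mapped
to its category of simplices. -/
@[reducible]
def SSetDiagram : Diagram.{u + 1} where
  D := SSetU.{u}
  R := elR SimplexCategoryᵒᵖ

open Diagram in
/-- The bigrading of the category `S ⋉_ψ SSet`: an object `(s, t)`, with `s` an `m`-simplex and `t` an
`n`-simplex of `ψ(s)`, goes to `(m, n)`, and a morphism goes to its pair of simplicial operators. -/
def bigrading (p : Param SSetDiagram.{u} SSetDiagram.{u}) :
    (tensor SSetDiagram.{u} SSetDiagram.{u}).R.obj p ⥤ SimplexCategoryᵒᵖ × SimplexCategoryᵒᵖ where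
  obj x := (x.base.base, x.fiber.base)
  map f := Prod.mkHom f.base.opr f.fiber.opr
  map_id x := Prod.ext rfl (El.eqToHom_opr (Gr.map_id_obj _ _ _))
  map_comp {x _ _} f g := Prod.ext rfl <| by
    have h := El.eqToHom_opr (Gr.map_comp_obj (p.ψ ⋙ SSetDiagram.R) f.base g.base x.fiber)
    exact (congrArg (· ≫ _) h).trans (Category.id_comp _)

open Diagram in
/-- `𝒯` together with `δ : T ⥤ S ⋉_ψ SSet` is the diagonal of the bisimplicial set whose category of
simplices is `S ⋉_ψ SSet`, where `p = (𝒮, ψ)`. That is, there is a bisimplicial set `𝕋` with an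
isomorphism `E`, compatible with the bigradings, between its category of simplices and
`S ⋉_ψ SSet`, and an isomorphism `e` from `𝒯` to the diagonal of `𝕋` for which `δ` is the diagonal
functor `t ↦ t`, sending an `n`-simplex of `𝒯` to the `(n, n)`-simplex of `𝕋` that it is. -/
def IsDiagonal (p : Param SSetDiagram.{u} SSetDiagram.{u}) (𝒯 : SSetU.{u})
    (δ : El 𝒯 ⥤ (tensor SSetDiagram.{u} SSetDiagram.{u}).R.obj p) : Prop :=
  ∃ (𝕋 : BiSSetU.{u})
    (E : (elR _).obj 𝕋 ≅ (tensor SSetDiagram.{u} SSetDiagram.{u}).R.obj p)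
    (e : 𝒯 ≅ Functor.diag SimplexCategoryᵒᵖ ⋙ 𝕋),
    E.hom.toFunctor ⋙ bigrading p = El.proj 𝕋 ∧
    δ = El.mapEl e.hom ⋙ El.pre (Functor.diag SimplexCategoryᵒᵖ) 𝕋 ⋙ E.hom.toFunctor

end ClubSSet

/-!
The diagonal of the bisimplicial set of pairs `(s, t)`, with `t` a simplex of `ψ(s)`, is associative
and unital up to the evident bijections `((s, t), u) ↔ (s, (t, u))`, `(⋆, t) ↔ t` and `(s, ⋆) ↔ s`.
The club axioms demand equalities, so the point is to encode pairs by sets in such a way that these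
bijections become identities.

This is done by well-ordering every set of the universe (`USet.lt`), von Neumann ordinals in the
standard way. The sum `USet.sigma A B` of a family of sets is the ordinal of the lexicographic sum,
except that `USet.sigma I B` is the only summand and `USet.sigma A (fun _ => I)` is `A`, where
`I = {{∅}}` is a one-point set that is not an ordinal. In all cases the lexicographic sum is order
isomorphic to `USet.sigma A B` (`USet.pairIso`). Since a sum can only be `I` if all its constituents
are, the exceptional cases do not interfere with associativity (`USet.sigma_assoc`), which elsewhere
holds because isomorphic well-orders have the same ordinal. Since well-orders are rigid
(`USet.relIso_val_eq`), the two ways of encoding a triple give the same element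
(`USet.pair_assoc_val`), and likewise for the units (`USet.pair_one_val`, `USet.val_pair_one`).

With this encoding `bisum S ψ` is the required bisimplicial set, `bisumElIso` identifies its
category of simplices, and `mul` is the multiplication. The axioms (`one_mul`, `mul_one`, `mul_assoc`)
compare functors. The sets and maps involved are compared through the underlying sets of elements, on
which transport along an equality is the identity. Functors between categories of simplices are
determined by their values on objects, as they all act on operators by `θ ↦ (θ, …, θ)` and the
functors to tuples of operators (`grading`) are faithful; this is `El.functor_heq`. Nothing depends
on the category of simplicial operators, so the construction is made for functors on any category `C`.
-/

namespace ClubSSet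

/-! ### Lexicographic sums of well-orders -/

section Lex

universe v₁ v₂ v₃

variable {α : Type v₁} {β : α → Type v₂}

instance isWellOrder_lex (r : α → α → Prop) (s : ∀ a, β a → β a → Prop) [IsWellOrder α r]
    [∀ a, IsWellOrder (β a) (s a)] : IsWellOrder (Σ a, β a) (Sigma.Lex r s) where
  wf := ⟨fun ⟨a, b⟩ => by
    induction a using IsWellFounded.induction r with
    | _ a iha =>
    induction b using IsWellFounded.induction (s a) with
    | _ b ihb =>
    refine ⟨_, fun y hy => ?_⟩
    cases hy with
    | left _ _ h => exact iha _ h _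
    | right _ _ h => exact ihb _ h⟩

theorem lex_right_iff {r : α → α → Prop} {s : ∀ a, β a → β a → Prop} [Std.Irrefl r] {a : α}
    {b b' : β a} : Sigma.Lex r s ⟨a, b⟩ ⟨a, b'⟩ ↔ s a b b' := by
  refine ⟨fun h => ?_, Sigma.Lex.right _ _⟩
  cases h with
  | left _ _ h => exact (irrefl _ h).elim
  | right _ _ h => exact h

/-- A relation-preserving bijection of bases and of fibres induces one of lexicographic sums. -/
def lexCongr {α' : Type v₃} {β' : α' → Type v₂} {r : α → α → Prop}
    {s : ∀ a, β a → β a → Prop} {r' : α' → α' → Prop} {s' : ∀ a, β' a → β' a → Prop}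
    [Std.Irrefl r] [Std.Irrefl r'] (e : r ≃r r') (f : ∀ a, s a ≃r s' (e a)) :
    Sigma.Lex r s ≃r Sigma.Lex r' s' where
  toEquiv := e.toEquiv.sigmaCongr fun a => (f a).toEquiv
  map_rel_iff' := by
    rintro ⟨a, b⟩ ⟨a', b'⟩
    constructor
    · intro h
      by_cases ha : a = a'
      · subst ha
        exact Sigma.Lex.right _ _ ((f a).map_rel_iff.1 (lex_right_iff.1 h))
      · refine Sigma.Lex.left _ _ (e.map_rel_iff.1 ?_)
        rcases Sigma.lex_iff.1 h with h | ⟨h, -⟩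
        · exact h
        · exact (ha (e.injective h)).elim
    · rintro (⟨_, _, h⟩ | ⟨_, _, h⟩)
      · exact Sigma.Lex.left _ _ (e.map_rel_iff.2 h)
      · exact Sigma.Lex.right _ _ ((f _).map_rel_iff.2 h)

/-- Lexicographic sums are associative. -/
def lexAssoc {γ : (Σ a, β a) → Type v₃} (r : α → α → Prop) (s : ∀ a, β a → β a → Prop)
    (t : ∀ p, γ p → γ p → Prop) :
    Sigma.Lex (Sigma.Lex r s) t ≃r Sigma.Lex r fun a => Sigma.Lex (s a) fun b => t ⟨a, b⟩ where
  toFun x := ⟨x.1.1, x.1.2, x.2⟩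
  invFun x := ⟨⟨x.1, x.2.1⟩, x.2.2⟩
  map_rel_iff' := by
    rintro ⟨⟨a, b⟩, c⟩ ⟨⟨a', b'⟩, c'⟩
    constructor
    · rintro (⟨_, _, h⟩ | ⟨_, _, ⟨_, _, h⟩ | ⟨_, _, h⟩⟩)
      · exact .left _ _ (.left _ _ h)
      · exact .left _ _ (.right _ _ h)
      · exact .right _ _ h
    · rintro (⟨_, _, ⟨_, _, h⟩ | ⟨_, _, h⟩⟩ | ⟨_, _, h⟩)
      · exact .left _ _ h
      · exact .right _ _ (.left _ _ h)
      · exact .right _ _ (.right _ _ h)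

/-- A lexicographic sum over a point is its only summand. -/
def lexUnique [Unique α] (r : α → α → Prop) [Std.Irrefl r] (s : ∀ a, β a → β a → Prop) :
    Sigma.Lex r s ≃r s default where
  toEquiv := Equiv.uniqueSigma β
  map_rel_iff' := by
    rintro ⟨a, b⟩ ⟨a', b'⟩
    obtain rfl := Unique.eq_default a
    obtain rfl := Unique.eq_default a'
    exact lex_right_iff.symm

/-- A lexicographic sum of points is its base. -/
def lexSigmaUnique [∀ a, Unique (β a)] (r : α → α → Prop) (s : ∀ a, β a → β a → Prop)
    [∀ a, Std.Irrefl (s a)] : Sigma.Lex r s ≃r r where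
  toEquiv := Equiv.sigmaUnique α β
  map_rel_iff' := by
    rintro ⟨a, b⟩ ⟨a', b'⟩
    refine ⟨.left _ _, fun h => ?_⟩
    rcases Sigma.lex_iff.1 h with h | ⟨h', h⟩
    · exact h
    obtain rfl : a = a' := h'
    exact (irrefl b (by rwa [Subsingleton.elim b' b] at h)).elim

/-- Well-orders are rigid. -/
theorem relIso_unique {α : Type v₁} {β : Type v₂} {r : α → α → Prop} {s : β → β → Prop}
    [IsWellOrder β s] (f g : r ≃r s) (a : α) : f a = g a :=
  congrArg (fun k : InitialSeg r s => k a)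
    (Subsingleton.elim f.toInitialSeg g.toInitialSeg)

end Lex

/-! ### The Mostowski collapse of a well-order -/

section Collapse

universe v v'

variable {α : Type v} {β : Type v'}

/-- The Mostowski collapse of the element `a`: the set of collapses of its predecessors. -/
noncomputable def collapse [Small.{u} α] (r : α → α → Prop) [IsWellFounded α r] :
    α → ZFSet.{u} :=
  IsWellFounded.fix r fun a ih => ZFSet.range fun b : {b // r b a} => ih b b.2

theorem collapse_eq [Small.{u} α] (r : α → α → Prop) [IsWellFounded α r] (a : α) :
    collapse r a = ZFSet.range fun b : {b // r b a} => collapse.{u} r b :=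
  IsWellFounded.fix_eq _ _ _

theorem collapse_mem [Small.{u} α] {r : α → α → Prop} [IsWellFounded α r] {a b : α} (h : r a b) :
    collapse.{u} r a ∈ collapse.{u} r b := by
  rw [collapse_eq r b]
  exact ZFSet.mem_range.2 ⟨⟨a, h⟩, rfl⟩

theorem collapse_relIso [Small.{u} α] [Small.{u} β] {r : α → α → Prop} {s : β → β → Prop}
    [IsWellFounded α r] [IsWellFounded β s] (e : r ≃r s) (a : α) :
    collapse.{u} s (e a) = collapse.{u} r a := by
  induction a using IsWellFounded.induction r with
  | _ a ih =>
  rw [collapse_eq, collapse_eq]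
  ext x
  simp only [ZFSet.mem_range, Subtype.exists, exists_prop]
  constructor
  · rintro ⟨b, hb, rfl⟩
    have hb' : r (e.symm b) a := by simpa [← e.map_rel_iff] using hb
    exact ⟨_, hb', by simpa using (ih _ hb').symm⟩
  · rintro ⟨b, hb, rfl⟩
    exact ⟨e b, e.map_rel_iff.2 hb, ih _ hb⟩

/-- The Mostowski collapse of a well-order: a von Neumann ordinal. -/
noncomputable def collapseSet [Small.{u} α] (r : α → α → Prop) [IsWellFounded α r] : USet.{u} :=
  ⟨ZFSet.range (collapse.{u} r)⟩

theorem collapseSet_congr [Small.{u} α] [Small.{u} β] {r : α → α → Prop} {s : β → β → Prop}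
    [IsWellFounded α r] [IsWellFounded β s] (e : r ≃r s) :
    collapseSet.{u} r = collapseSet.{u} s := by
  refine congrArg USet.mk ?_
  ext x
  simp only [ZFSet.mem_range]
  constructor
  · rintro ⟨a, rfl⟩
    exact ⟨e a, collapse_relIso e a⟩
  · rintro ⟨b, rfl⟩
    exact ⟨e.symm b, by simpa using (collapse_relIso e (e.symm b)).symm⟩

/-- The collapse is recovered from ranks, so that the order of a von Neumann ordinal can be read off
from the set. -/
theorem rank_collapse_lt_iff [Small.{u} α] {r : α → α → Prop} [IsWellOrder α r] {a b : α} :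
    (collapse.{u} r a).rank < (collapse.{u} r b).rank ↔ r a b := by
  refine ⟨fun h => ?_, fun h => ZFSet.rank_lt_of_mem (collapse_mem h)⟩
  rcases trichotomous_of r a b with h' | rfl | h'
  · exact h'
  · exact (lt_irrefl _ h).elim
  · exact (lt_asymm h (ZFSet.rank_lt_of_mem (collapse_mem h'))).elim

theorem rank_collapse_injective [Small.{u} α] {r : α → α → Prop} [IsWellOrder α r] {a b : α}
    (h : (collapse.{u} r a).rank = (collapse.{u} r b).rank) : a = b := by
  rcases trichotomous_of r a b with h' | h' | h'
  · exact (lt_irrefl _ (h ▸ rank_collapse_lt_iff.2 h')).elim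
  · exact h'
  · exact (lt_irrefl _ (h ▸ rank_collapse_lt_iff.2 h')).elim

end Collapse

/-! ### Strictly associative and unital sums of sets -/

namespace USet

/-- The strict unit for sums: the singleton of `{∅}`, chosen because it is not an ordinal. -/
def one : USet.{u} := ⟨{{∅}}⟩

instance : Unique one.{u}.Elem where
  default := ⟨{∅}, ZFSet.mem_singleton.2 rfl⟩
  uniq x := Subtype.ext (ZFSet.mem_singleton.1 x.2)

/-- A collapse with an element `{∅}` also has the element `∅`. -/
theorem collapseSet_ne_one {α : Type*} [Small.{u} α] (r : α → α → Prop) [IsWellFounded α r] :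
    collapseSet.{u} r ≠ one := by
  intro h
  have h' (x : ZFSet) : x ∈ ZFSet.range (collapse.{u} r) ↔ x = {∅} := by
    rw [← ZFSet.mem_singleton]
    exact iff_of_eq (congrArg (fun A : USet.{u} => x ∈ A.carrier) h)
  obtain ⟨a, ha⟩ := ZFSet.mem_range.1 ((h' {∅}).2 rfl)
  have h0 : (∅ : ZFSet.{u}) ∈ collapse.{u} r a := ha ▸ ZFSet.mem_singleton.2 rfl
  rw [collapse_eq] at h0
  obtain ⟨b, hb⟩ := ZFSet.mem_range.1 h0
  have h1 := (h' ∅).1 (ZFSet.mem_range.2 ⟨b, hb⟩)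
  have h2 : (∅ : ZFSet.{u}) ∈ ({∅} : ZFSet.{u}) := ZFSet.mem_singleton.2 rfl
  rw [← h1] at h2
  exact ZFSet.notMem_empty _ h2

instance (A : USet.{u}) : Small.{u} A.Elem := ZFSet.small_coe A.carrier

open Classical in
/-- A well-order on each set of the universe: by rank if the elements have distinct ranks, so that
it is the standard order on von Neumann ordinals, and an arbitrary one otherwise. -/
def lt (A : USet.{u}) : A.Elem → A.Elem → Prop :=
  if Function.Injective fun x : A.Elem => x.1.rank then fun x y => x.1.rank < y.1.rank
  else WellOrderingRel

instance (A : USet.{u}) : IsWellOrder A.Elem A.lt := by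
  unfold lt
  split
  · next h =>
    exact
      { wf := InvImage.wf (fun x : A.Elem => x.1.rank) wellFounded_lt
        trichotomous := fun a b h₁ h₂ => h (le_antisymm (not_lt.1 h₂) (not_lt.1 h₁)) }
  · infer_instance

/-- A well-order is isomorphic to its collapse with the chosen order. -/
theorem nonempty_relIso_collapseSet {α : Type*} [Small.{u} α] (r : α → α → Prop)
    [IsWellOrder α r] : Nonempty (r ≃r (collapseSet.{u} r).lt) := by
  have hinj : Function.Injective fun x : (collapseSet.{u} r).Elem => x.1.rank := by
    rintro ⟨x, hx⟩ ⟨y, hy⟩ h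
    obtain ⟨a, rfl⟩ := ZFSet.mem_range.1 hx
    obtain ⟨b, rfl⟩ := ZFSet.mem_range.1 hy
    obtain rfl := rank_collapse_injective h
    rfl
  refine ⟨⟨Equiv.ofBijective (fun a => ⟨collapse r a, ZFSet.mem_range.2 ⟨a, rfl⟩⟩) ⟨?_, ?_⟩, ?_⟩⟩
  · intro a b h
    exact rank_collapse_injective (congrArg (fun x => x.1.rank) h)
  · rintro ⟨x, hx⟩
    obtain ⟨a, rfl⟩ := ZFSet.mem_range.1 hx
    exact ⟨a, rfl⟩
  · intro a b
    unfold lt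
    rw [if_pos hinj]
    exact rank_collapse_lt_iff

open Classical in
/-- The sum of a family of sets. Away from the two cases forced by the unit laws, it is the ordinal
sum of the order types of the summands. -/
noncomputable def sigma (A : USet.{u}) (B : A.Elem → USet.{u}) : USet.{u} :=
  if h : A = one then B ⟨{∅}, h ▸ ZFSet.mem_singleton.2 rfl⟩
  else if ∀ a, B a = one then A
  else collapseSet (Sigma.Lex A.lt fun a => (B a).lt)

theorem one_sigma (B : one.{u}.Elem → USet.{u}) : sigma one B = B default := dif_pos rfl

theorem sigma_one (A : USet.{u}) : sigma A (fun _ => one) = A := by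
  unfold sigma
  split
  · next h => exact h.symm
  · exact if_pos fun _ => rfl

theorem sigma_eq_collapseSet {A : USet.{u}} {B : A.Elem → USet.{u}} (hA : A ≠ one)
    (hB : ¬ ∀ a, B a = one) :
    sigma A B = collapseSet (Sigma.Lex A.lt fun a => (B a).lt) := by
  unfold sigma
  rw [dif_neg hA, if_neg hB]

/-- The exceptional cases of `sigma` have the order type of the lexicographic sum as well. -/
theorem nonempty_relIso_sigma (A : USet.{u}) (B : A.Elem → USet.{u}) :
    Nonempty (Sigma.Lex A.lt (fun a => (B a).lt) ≃r (sigma A B).lt) := by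
  by_cases hA : A = one
  · subst hA
    rw [one_sigma]
    exact ⟨lexUnique _ _⟩
  by_cases hB : ∀ a, B a = one
  · obtain rfl : B = fun _ => one := funext hB
    rw [sigma_one]
    exact ⟨lexSigmaUnique _ _⟩
  rw [sigma_eq_collapseSet hA hB]
  exact nonempty_relIso_collapseSet _

/-- The order isomorphism from the lexicographic sum to `sigma A B`. -/
noncomputable def pairIso (A : USet.{u}) (B : A.Elem → USet.{u}) :
    Sigma.Lex A.lt (fun a => (B a).lt) ≃r (sigma A B).lt :=
  (nonempty_relIso_sigma A B).some

/-- The element of `sigma A B` that encodes the pair `(a, b)`. -/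
noncomputable def pair {A : USet.{u}} {B : A.Elem → USet.{u}} (a : A.Elem) (b : (B a).Elem) :
    (sigma A B).Elem :=
  pairIso A B ⟨a, b⟩

/-- The pair encoded by an element of `sigma A B`. -/
noncomputable def unpair {A : USet.{u}} {B : A.Elem → USet.{u}} (x : (sigma A B).Elem) :
    Σ a, (B a).Elem :=
  (pairIso A B).symm x

section

variable {A : USet.{u}} {B : A.Elem → USet.{u}}

@[simp] theorem unpair_pair (a : A.Elem) (b : (B a).Elem) : unpair (pair a b) = ⟨a, b⟩ :=
  (pairIso A B).symm_apply_apply _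

theorem pair_unpair (x : (sigma A B).Elem) : pair (unpair x).1 (unpair x).2 = x :=
  (pairIso A B).apply_symm_apply x

theorem exists_pair (x : (sigma A B).Elem) : ∃ a b, x = pair a b :=
  ⟨_, _, (pair_unpair x).symm⟩

theorem pair_val_congr {A' : USet.{u}} {B' : A'.Elem → USet.{u}} (hA : A = A')
    (hB : ∀ a a', a.1 = a'.1 → B a = B' a') {a : A.Elem} {b : (B a).Elem} {a' : A'.Elem}
    {b' : (B' a').Elem} (ha : a.1 = a'.1) (hb : b.1 = b'.1) : (pair a b).1 = (pair a' b').1 := by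
  subst hA
  obtain rfl : B = B' := funext fun a => hB a a rfl
  obtain rfl := Subtype.ext ha
  obtain rfl := Subtype.ext hb
  rfl

theorem pair_congr {a a' : A.Elem} {b : (B a).Elem} {b' : (B a').Elem} (ha : a = a')
    (hb : b.1 = b'.1) : pair a b = pair a' b' :=
  Subtype.ext (pair_val_congr rfl (fun _ _ h => congrArg B (Subtype.ext h)) (congrArg _ ha) hb)

theorem sigma_congr {A' : USet.{u}} {B' : A'.Elem → USet.{u}} (hA : A = A')
    (hB : ∀ a a', a.1 = a'.1 → B a = B' a') : sigma A B = sigma A' B' := by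
  subst hA
  exact congrArg _ (funext fun a => hB a a rfl)

end

/-- Order isomorphisms onto equal sets of the universe agree, since well-orders are rigid. -/
theorem relIso_val_eq {α : Type*} {r : α → α → Prop} {A A' : USet.{u}} (h : A = A')
    (f : r ≃r A.lt) (g : r ≃r A'.lt) (x : α) : (f x).1 = (g x).1 := by
  subst h
  exact congrArg _ (relIso_unique f g x)

theorem pair_one_val (B : one.{u}.Elem → USet.{u}) (a : one.Elem) (b : (B a).Elem) :
    (pair a b).1 = b.1 := by
  obtain rfl := Unique.eq_default a
  exact relIso_val_eq (one_sigma B) (pairIso one B) (lexUnique _ _) ⟨default, b⟩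

theorem val_pair_one (A : USet.{u}) (a : A.Elem) (b : one.Elem) :
    (pair (B := fun _ => one) a b).1 = a.1 :=
  relIso_val_eq (sigma_one A) (pairIso A _) (lexSigmaUnique _ _) ⟨a, b⟩

/-- The order isomorphism from a triple lexicographic sum to the sum over a sum. -/
noncomputable def tripleIso₁ (A : USet.{u}) (B : A.Elem → USet.{u})
    (C : (sigma A B).Elem → USet.{u}) :
    Sigma.Lex (Sigma.Lex A.lt fun a => (B a).lt) (fun p => (C (pairIso A B p)).lt) ≃r
      (sigma (sigma A B) C).lt :=
  (lexCongr (pairIso A B) fun _ => RelIso.refl _).trans (pairIso _ C)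

/-- The order isomorphism from a triple lexicographic sum to the sum of sums. -/
noncomputable def tripleIso₂ (A : USet.{u}) (B : A.Elem → USet.{u})
    (C : (sigma A B).Elem → USet.{u}) :
    Sigma.Lex (Sigma.Lex A.lt fun a => (B a).lt) (fun p => (C (pairIso A B p)).lt) ≃r
      (sigma A fun a => sigma (B a) fun b => C (pair a b)).lt :=
  (lexAssoc _ _ _).trans <|
    (lexCongr (RelIso.refl _) fun a => pairIso (B a) fun b => C (pair a b)).trans (pairIso A _)

/-- The unit is not a sum in a nontrivial way, being different from all ordinals. -/
theorem eq_one_of_sigma_eq_one {A : USet.{u}} {B : A.Elem → USet.{u}} (h : sigma A B = one) :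
    A = one ∧ ∀ a, B a = one := by
  by_cases hA : A = one
  · subst hA
    rw [one_sigma] at h
    exact ⟨rfl, fun a => Unique.eq_default a ▸ h⟩
  by_cases hB : ∀ a, B a = one
  · obtain rfl : B = fun _ => one := funext hB
    exact (hA ((sigma_one A).symm.trans h)).elim
  rw [sigma_eq_collapseSet hA hB] at h
  exact (collapseSet_ne_one _ h).elim

/-- Sums of sets are strictly associative. Away from the unit cases both sides are the ordinal of
the same triple lexicographic sum. -/
theorem sigma_assoc (A : USet.{u}) (B : A.Elem → USet.{u}) (C : (sigma A B).Elem → USet.{u}) :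
    sigma (sigma A B) C = sigma A fun a => sigma (B a) fun b => C (pair a b) := by
  by_cases hA : A = one
  · subst hA
    rw [one_sigma fun a => sigma (B a) fun b => C (pair a b)]
    refine sigma_congr (one_sigma B) fun x b h => congrArg C (Subtype.ext ?_)
    rw [pair_one_val, h]
  by_cases hB : ∀ a, B a = one
  · obtain rfl : B = fun _ => one := funext hB
    refine sigma_congr (sigma_one A) fun x a h => ?_
    rw [one_sigma]
    exact congrArg C (Subtype.ext (by rw [val_pair_one, h]))
  by_cases hC : ∀ x, C x = one
  · obtain rfl : C = fun _ => one := funext hC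
    simp only [sigma_one]
  -- Neither of the two outer sums is exceptional; the inner ones may be.
  rw [sigma_eq_collapseSet (fun h => hA (eq_one_of_sigma_eq_one h).1) hC, sigma_eq_collapseSet hA
    fun h => hB fun a => (eq_one_of_sigma_eq_one (h a)).1]
  refine collapseSet_congr (((lexCongr (pairIso A B) fun _ => RelIso.refl _).symm.trans
    (lexAssoc _ _ _)).trans (lexCongr (RelIso.refl _) fun a => pairIso (B a) _))

/-- Both sides are images of a triple under order isomorphisms from one well-order to one set. -/
theorem pair_assoc_val {A : USet.{u}} {B : A.Elem → USet.{u}} {C : (sigma A B).Elem → USet.{u}}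
    (a : A.Elem) (b : (B a).Elem) (c : (C (pair a b)).Elem) :
    (pair (pair a b) c).1 =
      (pair (B := fun a => sigma (B a) fun b => C (pair a b)) a (pair b c)).1 :=
  relIso_val_eq (sigma_assoc A B C) (tripleIso₁ A B C) (tripleIso₂ A B C) ⟨⟨a, b⟩, c⟩

end USet

/-! ### Equality of functors and of set-valued functors -/

theorem heq_of_faithful {A B : Type*} [Category A] [Category B] {π : A ⥤ B} (hπ : π.Faithful)
    {a b a' b' : A} {f : a ⟶ b} {f' : a' ⟶ b'} (ha : a = a') (hb : b = b')
    (h : π.map f ≍ π.map f') : f ≍ f' := by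
  subst ha hb
  exact heq_of_eq (π.map_injective (eq_of_heq h))

/-- Functors that agree on objects are equal once they agree after a faithful functor. -/
theorem functor_eq_of_faithful {A B E : Type*} [Category A] [Category B] [Category E]
    {F G : A ⥤ B} {π : B ⥤ E} (hπ : π.Faithful) (hobj : ∀ a, F.obj a = G.obj a)
    (h : F ⋙ π = G ⋙ π) : F = G :=
  CategoryTheory.Functor.hext hobj fun _ _ f =>
    heq_of_faithful hπ (hobj _) (hobj _) ((conj_eqToHom_iff_heq _ _ (congrArg π.obj (hobj _))
      (congrArg π.obj (hobj _))).1 (CategoryTheory.Functor.congr_hom h f))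

/-- The components of morphisms of diagrams have different sources until the underlying functors are
identified, so their comparison is heterogeneous. -/
theorem Diagram.hom_ext {X Y : Diagram.{w}} {f g : X ⟶ Y} (hF : f.F = g.F)
    (hρ : ∀ d, Hom.comp f d ≍ Hom.comp g d) : f = g := by
  obtain ⟨F, ρ⟩ := f
  obtain ⟨G, σ⟩ := g
  obtain rfl : F = G := hF
  congr 1
  ext1
  ext1 d
  exact Cat.ext (eq_of_heq (hρ d))

section SetValued

variable {C D : Type} [Category.{0} C] [Category.{0} D]

theorem map_val_congr {F : C ⥤ USet.{u}} {c d : C} (f : c ⟶ d) {x x' : (F.obj c).Elem}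
    (hx : x.1 = x'.1) : (F.map f x).1 = (F.map f x').1 := by
  rw [Subtype.ext hx]

theorem eqToHom_val {A B : USet.{u}} (h : A = B) (x : A.Elem) :
    ((eqToHom h : A ⟶ B) x).1 = x.1 := by
  subst h; rfl

theorem eqToHom_app_val {F G : C ⥤ USet.{u}} (h : F = G) (c : C) (x : (F.obj c).Elem) :
    ((eqToHom h : F ⟶ G).app c x).1 = x.1 := by
  subst h; rfl

/-- Equality of set-valued functors, with elements compared as sets of the universe. -/
theorem presheaf_ext {F G : C ⥤ USet.{u}} (hobj : ∀ c, F.obj c = G.obj c)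
    (hmap : ∀ {c d} (f : c ⟶ d) (x : (F.obj c).Elem) (y : (G.obj c).Elem), x.1 = y.1 →
      (F.map f x).1 = (G.map f y).1) : F = G :=
  CategoryTheory.Functor.ext hobj fun c d f => by
    funext x
    apply Subtype.ext
    refine (hmap f x (eqToHom (hobj c) x) (eqToHom_val _ _).symm).trans ?_
    exact (eqToHom_val (hobj d).symm _).symm

/-- Equality of natural transformations, with elements compared as sets of the universe. -/
theorem nat_heq {F G F' G' : C ⥤ USet.{u}} (hF : F = F') (hG : G = G') {f : F ⟶ G} {f' : F' ⟶ G'}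
    (h : ∀ c (x : (F.obj c).Elem) (x' : (F'.obj c).Elem), x.1 = x'.1 →
      (f.app c x).1 = (f'.app c x').1) : f ≍ f' := by
  subst hF hG
  refine heq_of_eq ?_
  ext1
  ext1 c
  funext x
  exact Subtype.ext (h c x x rfl)

theorem map_app_val_congr {A : Type*} [Category A] (χ : A ⥤ C ⥤ USet.{u}) {a b a' b' : A}
    {f : a ⟶ b} {f' : a' ⟶ b'} (ha : a = a') (hb : b = b') (hf : f ≍ f') {c : C}
    {x : ((χ.obj a).obj c).Elem} {x' : ((χ.obj a').obj c).Elem} (hx : x.1 = x'.1) :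
    ((χ.map f).app c x).1 = ((χ.map f').app c x').1 := by
  subst ha hb
  obtain rfl := eq_of_heq hf
  obtain rfl := Subtype.ext hx
  rfl

theorem El.obj_ext {F : C ⥤ USet.{u}} {c : C} {x y : (F.obj c).Elem} (h : x.1 = y.1) :
    (⟨c, x⟩ : El F) = ⟨c, y⟩ :=
  congrArg _ (Subtype.ext h)

instance El.proj_faithful (F : C ⥤ USet.{u}) : (El.proj F).Faithful where
  map_injective h := El.hom_ext h

/-- A functor out of a category of elements is determined by its values on objects, once it is
known after composition with a faithful functor. -/
theorem El.functor_heq {F F' : C ⥤ USet.{u}} (hF : F = F') {B E : Type*} [Category B] [Category E]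
    {G : El F ⥤ B} {G' : El F' ⥤ B} {π : B ⥤ E} (hπ : π.Faithful) (K : C ⥤ E)
    (hG : G ⋙ π = El.proj F ⋙ K) (hG' : G' ⋙ π = El.proj F' ⋙ K)
    (hobj : ∀ c (x : (F.obj c).Elem) (x' : (F'.obj c).Elem), x.1 = x'.1 →
      G.obj ⟨c, x⟩ = G'.obj ⟨c, x'⟩) : G ≍ G' := by
  subst hF
  exact heq_of_eq (functor_eq_of_faithful hπ (fun x => hobj _ _ _ rfl) (hG.trans hG'.symm))

end SetValued

/-! ### The bisimplicial sum -/

section Bisum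

variable {C D : Type} [Category.{0} C] [Category.{0} D]

/-- The action of a pair of operators on pairs `(s, t)`. -/
def bisumAct (S : C ⥤ USet.{u}) (ψ : El S ⥤ D ⥤ USet.{u}) {x y : C × D} (f : x ⟶ y)
    (p : Σ s : (S.obj x.1).Elem, ((ψ.obj ⟨x.1, s⟩).obj x.2).Elem) :
    Σ s : (S.obj y.1).Elem, ((ψ.obj ⟨y.1, s⟩).obj y.2).Elem :=
  ⟨S.map f.1 p.1, (ψ.map (X := ⟨x.1, p.1⟩) (Y := ⟨y.1, S.map f.1 p.1⟩) ⟨f.1, rfl⟩).app y.2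
    ((ψ.obj ⟨x.1, p.1⟩).map f.2 p.2)⟩

theorem sigma_ext {A : USet.{u}} {B : A.Elem → USet.{u}} {p q : Σ a, (B a).Elem}
    (h₁ : p.1 = q.1) (h₂ : p.2.1 = q.2.1) : p = q := by
  obtain ⟨a, b⟩ := p
  obtain ⟨a', b'⟩ := q
  obtain rfl : a = a' := h₁
  exact congrArg _ (Subtype.ext h₂)

/-- The action of a morphism of `El S` depends only on its operator; the targets are then equal,
but not by definition. -/
theorem El.map_app_val {S : C ⥤ USet.{u}} (ψ : El S ⥤ D ⥤ USet.{u}) {c d : C}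
    {s : (S.obj c).Elem} {t t' : (S.obj d).Elem} (f : (⟨c, s⟩ : El S) ⟶ ⟨d, t⟩)
    (f' : (⟨c, s⟩ : El S) ⟶ ⟨d, t'⟩) (h : f.opr = f'.opr) {n : D}
    (x : ((ψ.obj ⟨c, s⟩).obj n).Elem) :
    ((ψ.map f).app n x).1 = ((ψ.map f').app n x).1 := by
  obtain rfl : t = t' := f.map_pt.symm.trans ((congrArg (fun k => S.map k s) h).trans f'.map_pt)
  obtain rfl : f = f' := El.hom_ext h
  rfl

theorem bisumAct_id (S : C ⥤ USet.{u}) (ψ : El S ⥤ D ⥤ USet.{u}) (x : C × D)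
    (p : Σ s : (S.obj x.1).Elem, ((ψ.obj ⟨x.1, s⟩).obj x.2).Elem) : bisumAct S ψ (𝟙 x) p = p := by
  obtain ⟨s, t⟩ := p
  refine sigma_ext (B := fun s => (ψ.obj ⟨x.1, s⟩).obj x.2) (congrFun (S.map_id x.1) s) ?_
  let α : (⟨x.1, s⟩ : El S) ⟶ ⟨x.1, S.map (𝟙 x.1) s⟩ := ⟨𝟙 x.1, rfl⟩
  change ((ψ.map α).app x.2 ((ψ.obj ⟨x.1, s⟩).map (𝟙 x.2) t)).1 = t.1
  refine (El.map_app_val ψ α (𝟙 (⟨x.1, s⟩ : El S)) rfl _).trans ?_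
  rw [ψ.map_id]
  exact congrArg Subtype.val (congrFun ((ψ.obj ⟨x.1, s⟩).map_id x.2) t)

theorem bisumAct_comp (S : C ⥤ USet.{u}) (ψ : El S ⥤ D ⥤ USet.{u}) {x y z : C × D} (f : x ⟶ y)
    (g : y ⟶ z) (p : Σ s : (S.obj x.1).Elem, ((ψ.obj ⟨x.1, s⟩).obj x.2).Elem) :
    bisumAct S ψ (f ≫ g) p = bisumAct S ψ g (bisumAct S ψ f p) := by
  obtain ⟨s, t⟩ := p
  refine sigma_ext (B := fun s => (ψ.obj ⟨z.1, s⟩).obj z.2) (congrFun (S.map_comp f.1 g.1) s) ?_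
  let α : (⟨x.1, s⟩ : El S) ⟶ ⟨y.1, S.map f.1 s⟩ := ⟨f.1, rfl⟩
  let β : (⟨y.1, S.map f.1 s⟩ : El S) ⟶ ⟨z.1, S.map g.1 (S.map f.1 s)⟩ := ⟨g.1, rfl⟩
  let γ : (⟨x.1, s⟩ : El S) ⟶ ⟨z.1, S.map (f.1 ≫ g.1) s⟩ := ⟨f.1 ≫ g.1, rfl⟩
  change ((ψ.map γ).app z.2 ((ψ.obj ⟨x.1, s⟩).map (f.2 ≫ g.2) t)).1 = _
  refine (El.map_app_val ψ γ (α ≫ β) rfl _).trans (congrArg Subtype.val ?_)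
  change (ψ.map (α ≫ β)).app z.2 ((ψ.obj ⟨x.1, s⟩).map (f.2 ≫ g.2) t) =
    (ψ.map β).app z.2 ((ψ.obj _).map g.2 ((ψ.map α).app y.2 ((ψ.obj ⟨x.1, s⟩).map f.2 t)))
  rw [ψ.map_comp, Functor.map_comp]
  exact congrArg ((ψ.map β).app z.2) (congrFun ((ψ.map α).naturality g.2) _)

/-- The bisimplicial set with `(m, n)`-simplices the pairs `(s, t)` of an `m`-simplex `s` of `S` and
an `n`-simplex `t` of `ψ(s)`, the set of pairs being encoded by `USet.sigma`. -/
noncomputable def bisum (S : C ⥤ USet.{u}) (ψ : El S ⥤ D ⥤ USet.{u}) : C × D ⥤ USet.{u} where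
  obj x := USet.sigma (S.obj x.1) fun s => (ψ.obj ⟨x.1, s⟩).obj x.2
  map f := fun z => USet.pairIso _ _ (bisumAct S ψ f (USet.unpair z))
  map_id x := by
    funext z
    rw [bisumAct_id]
    exact USet.pair_unpair z
  map_comp f g := by
    funext z
    change _ = USet.pairIso _ _ (bisumAct S ψ g (USet.unpair (USet.pair _ _)))
    rw [USet.unpair_pair, bisumAct_comp]
    rfl

theorem unpair_bisum_map (S : C ⥤ USet.{u}) (ψ : El S ⥤ D ⥤ USet.{u}) {x y : C × D} (f : x ⟶ y)
    (z : ((bisum S ψ).obj x).Elem) :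
    USet.unpair ((bisum S ψ).map f z) = bisumAct S ψ f (USet.unpair z) :=
  (USet.pairIso _ _).symm_apply_apply _

theorem bisum_map_pair (S : C ⥤ USet.{u}) (ψ : El S ⥤ D ⥤ USet.{u}) {x y : C × D} (f : x ⟶ y)
    (s : (S.obj x.1).Elem) (t : ((ψ.obj ⟨x.1, s⟩).obj x.2).Elem) :
    (bisum S ψ).map f (USet.pair s t) =
      USet.pair (S.map f.1 s) ((ψ.map (X := ⟨x.1, s⟩) (Y := ⟨y.1, S.map f.1 s⟩) ⟨f.1, rfl⟩).app y.2
        ((ψ.obj ⟨x.1, s⟩).map f.2 t)) := by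
  change USet.pairIso _ _ (bisumAct S ψ f (USet.unpair (USet.pair s t))) = _
  rw [USet.unpair_pair]
  rfl

end Bisum

/-! ### Categories of pairs and their gradings -/

section Grading

variable {C D : Type} [Category.{0} C] [Category.{0} D]

/-- A grading `π` of `A` and the grading of the categories of elements by their operators combine to
a grading of the category of pairs. -/
def grading {A : Type (u + 1)} [SmallCategory A] {B : Type*} [Category B] (π : A ⥤ B)
    (χ : A ⥤ D ⥤ USet.{u}) : Diagram.Gr (χ ⋙ elR D) ⥤ B × D where
  obj x := (π.obj x.base, x.fiber.base)
  map f := Prod.mkHom (π.map f.base) f.fiber.opr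
  map_id x := Prod.ext (π.map_id _) (El.eqToHom_opr (Diagram.Gr.map_id_obj _ _ _))
  map_comp {x _ _} f g := Prod.ext (π.map_comp _ _) <| by
    have h := El.eqToHom_opr (Diagram.Gr.map_comp_obj (χ ⋙ elR D) f.base g.base x.fiber)
    exact (congrArg (· ≫ _) h).trans (Category.id_comp _)

end Grading

section Grading

variable {C D : Type} [Category.{0} C] [Category.{0} D]

theorem grading_faithful {A : Type (u + 1)} [SmallCategory A] {B : Type*} [Category B]
    {π : A ⥤ B} (hπ : π.Faithful) (χ : A ⥤ D ⥤ USet.{u}) : (grading π χ).Faithful where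
  map_injective {x y f g} h := by
    have h₁ : f.base = g.base := π.map_injective (congrArg Prod.fst h)
    refine Diagram.Gr.hom_ext h₁ (El.hom_ext ?_)
    refine (congrArg (· ≫ _) (El.eqToHom_opr _)).trans ((Category.id_comp _).trans ?_)
    exact congrArg Prod.snd h

/-- Equality of objects `(a, t)` of a category of pairs, with `t` compared as a set of the
universe. -/
theorem pair_obj_ext {A : Type (u + 1)} [SmallCategory A] {χ : A ⥤ D ⥤ USet.{u}} {a a' : A}
    (ha : a = a') {n : D} {t : ((χ.obj a).obj n).Elem} {t' : ((χ.obj a').obj n).Elem}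
    (ht : t.1 = t'.1) :
    (⟨a, (⟨n, t⟩ : El (χ.obj a))⟩ : Diagram.Gr (χ ⋙ elR D)) = ⟨a', (⟨n, t'⟩ : El (χ.obj a'))⟩ := by
  subst ha
  exact congrArg _ (El.obj_ext ht)

/-- The functor `(s, t) ↦ (s, t)` from the category of simplices of the bisimplicial sum to the
category of pairs. -/
noncomputable def bisumElHom (S : C ⥤ USet.{u}) (ψ : El S ⥤ D ⥤ USet.{u}) :
    El (bisum S ψ) ⥤ Diagram.Gr (ψ ⋙ elR D) where
  obj x := ⟨⟨x.base.1, (USet.unpair x.pt).1⟩,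
    (⟨x.base.2, (USet.unpair x.pt).2⟩ : El (ψ.obj ⟨x.base.1, (USet.unpair x.pt).1⟩))⟩
  map {x y} f :=
    have h : bisumAct S ψ f.opr (USet.unpair x.pt) = USet.unpair y.pt := by
      rw [← f.map_pt]
      exact (unpair_bisum_map S ψ f.opr x.pt).symm
    -- The second component of `unpair y.pt` lives in a set that depends on the first, so the
    -- condition on it is stated for an arbitrary pair equal to the image of `unpair x.pt`.
    have key : ∀ (q : Σ s : (S.obj y.base.1).Elem, ((ψ.obj ⟨y.base.1, s⟩).obj y.base.2).Elem)
        (_ : bisumAct S ψ f.opr (USet.unpair x.pt) = q)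
        (hs : S.map f.opr.1 (USet.unpair x.pt).1 = q.1),
        (ψ.obj ⟨y.base.1, q.1⟩).map f.opr.2 ((ψ.map (X := ⟨x.base.1, (USet.unpair x.pt).1⟩)
          (Y := ⟨y.base.1, q.1⟩) ⟨f.opr.1, hs⟩).app x.base.2 (USet.unpair x.pt).2) = q.2 := by
      rintro q rfl hs
      exact (congrFun ((ψ.map (X := ⟨x.base.1, (USet.unpair x.pt).1⟩)
          (Y := ⟨y.base.1, _⟩) ⟨f.opr.1, hs⟩).naturality f.opr.2) _).symm
    ⟨⟨f.opr.1, congrArg Sigma.fst h⟩, ⟨f.opr.2, key _ h (congrArg Sigma.fst h)⟩⟩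
  map_id x := (grading_faithful (El.proj_faithful S) ψ).map_injective <| by
    rw [CategoryTheory.Functor.map_id]
    rfl
  map_comp f g := (grading_faithful (El.proj_faithful S) ψ).map_injective <| by
    rw [Functor.map_comp]
    rfl

/-- The inverse functor `(s, t) ↦ (s, t)`. -/
noncomputable def bisumElInv (S : C ⥤ USet.{u}) (ψ : El S ⥤ D ⥤ USet.{u}) :
    Diagram.Gr (ψ ⋙ elR D) ⥤ El (bisum S ψ) where
  obj x := ⟨(x.base.base, x.fiber.base), USet.pair x.base.pt x.fiber.pt⟩
  map {x y} f := ⟨(grading (El.proj S) ψ).map f, by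
    obtain ⟨⟨m, s⟩, ⟨n, t⟩⟩ := x
    obtain ⟨⟨m', s'⟩, ⟨n', t'⟩⟩ := y
    obtain ⟨⟨f₁, h₁⟩, ⟨f₂, h₂⟩⟩ := f
    dsimp only at f₁ h₁ h₂ ⊢
    subst h₁
    refine (bisum_map_pair S ψ _ _ _).trans (USet.pair_congr rfl (congrArg Subtype.val ?_))
    refine Eq.trans ?_ h₂
    exact (congrFun ((ψ.map (X := ⟨m, s⟩) (Y := ⟨m', _⟩) ⟨f₁, rfl⟩).naturality f₂) t)⟩
  map_id x := El.hom_ext ((grading (El.proj S) ψ).map_id _)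
  map_comp f g := El.hom_ext ((grading (El.proj S) ψ).map_comp _ _)

theorem bisumElHom_grading (S : C ⥤ USet.{u}) (ψ : El S ⥤ D ⥤ USet.{u}) :
    bisumElHom S ψ ⋙ grading (El.proj S) ψ = El.proj (bisum S ψ) :=
  CategoryTheory.Functor.hext (fun _ => rfl) fun _ _ _ => HEq.rfl

theorem bisumElHom_obj_pair (S : C ⥤ USet.{u}) (ψ : El S ⥤ D ⥤ USet.{u}) (x : C × D)
    (s : (S.obj x.1).Elem) (t : ((ψ.obj ⟨x.1, s⟩).obj x.2).Elem) :
    (bisumElHom S ψ).obj ⟨x, USet.pair s t⟩ = ⟨⟨x.1, s⟩, (⟨x.2, t⟩ : El (ψ.obj ⟨x.1, s⟩))⟩ :=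
  congrArg (fun p : Σ s : (S.obj x.1).Elem, ((ψ.obj ⟨x.1, s⟩).obj x.2).Elem =>
    (⟨⟨x.1, p.1⟩, (⟨x.2, p.2⟩ : El (ψ.obj ⟨x.1, p.1⟩))⟩ : Diagram.Gr (ψ ⋙ elR D)))
    (USet.unpair_pair (B := fun s => (ψ.obj ⟨x.1, s⟩).obj x.2) s t)

theorem bisumElHom_comp_inv (S : C ⥤ USet.{u}) (ψ : El S ⥤ D ⥤ USet.{u}) :
    bisumElHom S ψ ⋙ bisumElInv S ψ = 𝟭 _ :=
  functor_eq_of_faithful (El.proj_faithful (bisum S ψ))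
    (fun x => congrArg (El.mk (F := bisum S ψ) x.base) (USet.pair_unpair x.pt))
    (CategoryTheory.Functor.hext (fun _ => rfl) fun _ _ _ => HEq.rfl)

theorem bisumElInv_comp_hom (S : C ⥤ USet.{u}) (ψ : El S ⥤ D ⥤ USet.{u}) :
    bisumElInv S ψ ⋙ bisumElHom S ψ = 𝟭 _ :=
  functor_eq_of_faithful (grading_faithful (El.proj_faithful S) ψ)
    (fun x => bisumElHom_obj_pair S ψ (x.base.base, x.fiber.base) x.base.pt x.fiber.pt)
    (CategoryTheory.Functor.hext (fun _ => rfl) fun _ _ _ => HEq.rfl)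

/-- The category of simplices of the bisimplicial sum is the category of pairs. -/
noncomputable def bisumElIso (S : C ⥤ USet.{u}) (ψ : El S ⥤ D ⥤ USet.{u}) :
    (elR (C × D)).obj (bisum S ψ) ≅
      (⟨Diagram.Gr (ψ ⋙ elR D), inferInstance⟩ : Cat.{u + 1, u + 1}) where
  hom := (bisumElHom S ψ).toCatHom
  inv := (bisumElInv S ψ).toCatHom
  hom_inv_id := Cat.ext (bisumElHom_comp_inv S ψ)
  inv_hom_id := Cat.ext (bisumElInv_comp_hom S ψ)

end Grading

/-! ### The multiplication -/

section Mul

variable (C : Type) [Category.{0} C]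

/-- The diagram of `USet`-valued functors on `C`, each mapped to its category of elements. -/
@[reducible]
def elDiagram : Diagram.{u + 1} where
  D := C ⥤ USet.{u}
  R := elR C

open Diagram

variable {C}

/-- The action `(s, t) ↦ (f s, φ_s t)` of a morphism `(f, φ)` on pairs. -/
def paramAct {p q : Param (elDiagram.{u} C) (elDiagram.{u} C)} (k : p ⟶ q) (x : C × C)
    (z : Σ s : (p.d.obj x.1).Elem, ((p.ψ.obj (⟨x.1, s⟩ : El p.d)).obj x.2).Elem) :
    Σ s : (q.d.obj x.1).Elem, ((q.ψ.obj (⟨x.1, s⟩ : El q.d)).obj x.2).Elem :=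
  ⟨k.f.app x.1 z.1, (k.φ (⟨x.1, z.1⟩ : El p.d)).app x.2 z.2⟩

theorem paramAct_naturality {p q : Param (elDiagram.{u} C) (elDiagram.{u} C)} (k : p ⟶ q)
    {x y : C × C} (f : x ⟶ y)
    (z : Σ s : (p.d.obj x.1).Elem, ((p.ψ.obj (⟨x.1, s⟩ : El p.d)).obj x.2).Elem) :
    paramAct k y (bisumAct p.d p.ψ f z) = bisumAct q.d q.ψ f (paramAct k x z) := by
  obtain ⟨s, t⟩ := z
  refine sigma_ext (B := fun s => (q.ψ.obj (⟨y.1, s⟩ : El q.d)).obj y.2)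
    (congrFun (k.f.naturality f.1) s) ?_
  let α : (⟨x.1, s⟩ : El p.d) ⟶ ⟨y.1, p.d.map f.1 s⟩ := ⟨f.1, rfl⟩
  have h₁ := congrFun (congrArg (fun l => NatTrans.app l y.2) (k.naturality α))
    ((p.ψ.obj (⟨x.1, s⟩ : El p.d)).map f.2 t)
  have h₂ := congrFun ((k.φ (⟨x.1, s⟩ : El p.d)).naturality f.2) t
  refine (congrArg Subtype.val h₁).trans ?_
  refine (congrArg (fun w => Subtype.val ((q.ψ.map ((El.mapEl k.f).map α)).app y.2 w)) h₂).trans ?_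
  exact El.map_app_val q.ψ ((El.mapEl k.f).map α)
    (⟨f.1, rfl⟩ : (⟨x.1, k.f.app x.1 s⟩ : El q.d) ⟶ ⟨y.1, q.d.map f.1 (k.f.app x.1 s)⟩) rfl _

theorem paramAct_id (p : Param (elDiagram.{u} C) (elDiagram.{u} C)) (x : C × C)
    (z : Σ s : (p.d.obj x.1).Elem, ((p.ψ.obj (⟨x.1, s⟩ : El p.d)).obj x.2).Elem) :
    paramAct (𝟙 p) x z = z :=
  sigma_ext (B := fun s => (p.ψ.obj (⟨x.1, s⟩ : El p.d)).obj x.2) rfl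
    (eqToHom_app_val rfl x.2 z.2)

theorem paramAct_comp {p q r : Param (elDiagram.{u} C) (elDiagram.{u} C)} (k : p ⟶ q) (l : q ⟶ r)
    (x : C × C)
    (z : Σ s : (p.d.obj x.1).Elem, ((p.ψ.obj (⟨x.1, s⟩ : El p.d)).obj x.2).Elem) :
    paramAct (k ≫ l) x z = paramAct l x (paramAct k x z) :=
  sigma_ext (B := fun s => (r.ψ.obj (⟨x.1, s⟩ : El r.d)).obj x.2) rfl
    (eqToHom_app_val rfl x.2 (paramAct l x (paramAct k x z)).2)

/-- The bisimplicial sum is functorial in the pair `(S, ψ)`. -/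
noncomputable def bisumF (C : Type) [Category.{0} C] :
    Param (elDiagram.{u} C) (elDiagram.{u} C) ⥤ C × C ⥤ USet.{u} where
  obj p := bisum p.d p.ψ
  map {p q} k :=
    { app := fun x z => USet.pairIso _ _ (paramAct k x (USet.unpair z))
      naturality := fun x y f => by
        funext z
        have h := (congrArg (paramAct k y) (unpair_bisum_map p.d p.ψ f z)).trans
          (paramAct_naturality k f (USet.unpair z))
        refine (congrArg (USet.pairIso _ _) h).trans ?_
        exact (congrArg (fun w => USet.pairIso _ _ (bisumAct q.d q.ψ f w))
          (USet.unpair_pair (paramAct k x (USet.unpair z)).1 _)).symm }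
  map_id p := by
    ext1
    ext1 x
    funext z
    exact (congrArg (USet.pairIso _ _) (paramAct_id p x (USet.unpair z))).trans (USet.pair_unpair z)
  map_comp {p q r} k l := by
    ext1
    ext1 x
    funext z
    refine (congrArg (USet.pairIso _ _) (paramAct_comp k l x (USet.unpair z))).trans ?_
    exact (congrArg (fun w => USet.pairIso _ _ (paramAct l x w))
      (USet.unpair_pair (paramAct k x (USet.unpair z)).1 _)).symm

theorem bisumF_map_app_pair {p q : Param (elDiagram.{u} C) (elDiagram.{u} C)} (k : p ⟶ q)
    (x : C × C) (s : (p.d.obj x.1).Elem) (t : ((p.ψ.obj (⟨x.1, s⟩ : El p.d)).obj x.2).Elem) :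
    ((bisumF C).map k).app x (USet.pair s t) =
      USet.pair (k.f.app x.1 s) ((k.φ (⟨x.1, s⟩ : El p.d)).app x.2 t) :=
  congrArg (fun w => USet.pairIso _ _ (paramAct k x w))
    (USet.unpair_pair (B := fun s => (p.ψ.obj (⟨x.1, s⟩ : El p.d)).obj x.2) s t)

/-- The functor `Δ`: the diagonal of the bisimplicial sum. -/
noncomputable def mulF (C : Type) [Category.{0} C] :
    Param (elDiagram.{u} C) (elDiagram.{u} C) ⥤ C ⥤ USet.{u} :=
  bisumF C ⋙ (Functor.whiskeringLeft _ _ _).obj (Functor.diag C)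

/-- The diagonal functor `δ`. -/
noncomputable def diagonal (p : Param (elDiagram.{u} C) (elDiagram.{u} C)) :
    El ((mulF C).obj p) ⥤ Gr (p.ψ ⋙ elR C) :=
  El.pre (Functor.diag C) (bisum p.d p.ψ) ⋙ bisumElHom p.d p.ψ

theorem diagonal_obj_pair (p : Param (elDiagram.{u} C) (elDiagram.{u} C)) (n : C)
    (s : (p.d.obj n).Elem) (t : ((p.ψ.obj (⟨n, s⟩ : El p.d)).obj n).Elem) :
    (diagonal p).obj ⟨n, USet.pair s t⟩ =
      ⟨(⟨n, s⟩ : El p.d), (⟨n, t⟩ : El (p.ψ.obj (⟨n, s⟩ : El p.d)))⟩ :=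
  bisumElHom_obj_pair p.d p.ψ (n, n) s t

/-- The diagonal functor sends an operator `θ` to `(θ, θ)`. -/
theorem diagonal_grading (p : Param (elDiagram.{u} C) (elDiagram.{u} C)) :
    diagonal p ⋙ grading (El.proj p.d) p.ψ = El.proj ((mulF C).obj p) ⋙ Functor.diag C :=
  CategoryTheory.Functor.hext (fun _ => rfl) fun _ _ _ => HEq.rfl

/-- The grading is compatible with functors between categories of pairs that preserve operators. -/
theorem map_grading {A A' : Type (u + 1)} [SmallCategory A] [SmallCategory A'] {B : Type*}
    [Category B] {π : A ⥤ B} {π' : A' ⥤ B} {χ : A ⥤ C ⥤ USet.{u}} {χ' : A' ⥤ C ⥤ USet.{u}}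
    (G : A ⥤ A') (hG : G ⋙ π' = π) (η : χ ⟶ G ⋙ χ') :
    Gr.map (P := χ ⋙ elR C) (Q := χ' ⋙ elR C) G (Functor.whiskerRight η (elR C)) ⋙
      grading π' χ' = grading π χ := by
  subst hG
  refine CategoryTheory.Functor.hext (fun _ => rfl) fun x y f => heq_of_eq (Prod.ext rfl ?_)
  exact (congrArg (· ≫ _) (El.eqToHom_opr _)).trans (Category.id_comp _)

theorem diagonal_naturality {p q : Param (elDiagram.{u} C) (elDiagram.{u} C)} (k : p ⟶ q) :
    El.mapEl ((mulF C).map k) ⋙ diagonal q = diagonal p ⋙ Gr.map (P := p.ψ ⋙ elR C)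
      (Q := q.ψ ⋙ elR C) (El.mapEl k.f) (Functor.whiskerRight (Param.Hom.nat k) (elR C)) := by
  refine functor_eq_of_faithful (grading_faithful (El.proj_faithful q.d) q.ψ) ?_ ?_
  · rintro ⟨n, z⟩
    obtain ⟨s, t, rfl⟩ := USet.exists_pair z
    refine Eq.trans (congrArg (fun z => (diagonal q).obj ⟨n, z⟩)
      (bisumF_map_app_pair k (n, n) s t)) ?_
    refine (diagonal_obj_pair q n _ _).trans ?_
    exact (congrArg ((tensorR _ _).map k).toFunctor.obj (diagonal_obj_pair p n s t)).symm
  · refine (congrArg (El.mapEl ((mulF C).map k) ⋙ ·) (diagonal_grading q)).trans ?_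
    refine Eq.trans ?_ (congrArg (diagonal p ⋙ ·) (map_grading (π := El.proj p.d)
      (π' := El.proj q.d) (El.mapEl k.f) rfl (Param.Hom.nat k))).symm
    exact (diagonal_grading p).symm

/-- The multiplication `(Δ, δ)`. -/
noncomputable def mul (C : Type) [Category.{0} C] :
    tensor (elDiagram.{u} C) (elDiagram.{u} C) ⟶ elDiagram.{u} C where
  F := mulF C
  ρ :=
    { app := fun p => (diagonal p).toCatHom
      naturality := fun p q k => by
        exact Cat.ext (diagonal_naturality k) }

end Mul

open Diagram

variable {C : Type} [Category.{0} C]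

theorem mulF_obj_map_pair (p : Param (elDiagram.{u} C) (elDiagram.{u} C)) {c d : C} (f : c ⟶ d)
    (s : (p.d.obj c).Elem) (t : ((p.ψ.obj (⟨c, s⟩ : El p.d)).obj c).Elem) :
    ((mulF C).obj p).map f (USet.pair s t) = USet.pair (p.d.map f s)
      ((p.ψ.map (⟨f, rfl⟩ : (⟨c, s⟩ : El p.d) ⟶ ⟨d, p.d.map f s⟩)).app d
        ((p.ψ.obj (⟨c, s⟩ : El p.d)).map f t)) :=
  bisum_map_pair p.d p.ψ (x := (c, c)) (y := (d, d)) (Prod.mkHom f f) s t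

theorem mulF_map_app_pair {p q : Param (elDiagram.{u} C) (elDiagram.{u} C)} (k : p ⟶ q) (c : C)
    (s : (p.d.obj c).Elem) (t : ((p.ψ.obj (⟨c, s⟩ : El p.d)).obj c).Elem) :
    ((mulF C).map k).app c (USet.pair s t) =
      USet.pair (k.f.app c s) ((k.φ (⟨c, s⟩ : El p.d)).app c t) :=
  bisumF_map_app_pair k (c, c) s t

/-- The unit `(I, ι)`, picking out the constant functor at the one-point set `USet.one`. -/
def one (C : Type) [Category.{0} C] : unit ⟶ elDiagram.{u} C where
  F := (Functor.const _).obj ((Functor.const C).obj USet.one)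
  ρ :=
    { app := fun _ => ((Functor.const _).obj ⟨⟨⟩⟩ : _ ⥤ Discrete PUnit.{u + 2}).toCatHom
      naturality := fun _ _ _ => Cat.ext (Functor.punit_ext' _ _) }

/-! ### The unit laws -/

theorem map_id_app_val {A : Type*} [Category A] (χ : A ⥤ C ⥤ USet.{u}) (a : A) {c : C}
    (x : ((χ.obj a).obj c).Elem) : ((χ.map (𝟙 a)).app c x).1 = x.1 := by
  rw [χ.map_id]
  rfl

theorem comp_eqToHom_app_val {F G H : C ⥤ USet.{u}} (f : F ⟶ G) (h : G = H) {c : C}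
    (x : (F.obj c).Elem) : ((f ≫ eqToHom h).app c x).1 = (f.app c x).1 :=
  eqToHom_app_val h c _

theorem one_mul_F : (tensorHom (one C) (𝟙 (elDiagram.{u} C)) ≫ mul C).F =
    (leftUnitor (elDiagram.{u} C)).F := by
  have hobj (p : Param unit (elDiagram.{u} C)) :
      (mulF C).obj ((tensorHomF (one C) (𝟙 (elDiagram.{u} C))).obj p) = p.ψ.obj ⟨⟨⟩⟩ := by
    refine presheaf_ext (fun c => USet.one_sigma _) fun {c d} f x y h => ?_
    obtain ⟨s, t, rfl⟩ := USet.exists_pair x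
    refine (congrArg Subtype.val (mulF_obj_map_pair _ f s t)).trans ?_
    refine (USet.pair_one_val _ _ _).trans ?_
    refine (map_id_app_val p.ψ ⟨⟨⟩⟩ _).trans ?_
    exact map_val_congr f ((USet.pair_one_val _ _ _).symm.trans h)
  refine CategoryTheory.Functor.hext hobj fun p q k => nat_heq (hobj p) (hobj q) fun c x y h => ?_
  obtain ⟨s, t, rfl⟩ := USet.exists_pair x
  refine (congrArg Subtype.val (mulF_map_app_pair _ c s t)).trans ?_
  refine (USet.pair_one_val _ _ _).trans ?_
  refine (comp_eqToHom_app_val (k.φ ⟨⟨⟩⟩) _ t).trans ?_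
  exact congrArg (fun w => ((k.φ ⟨⟨⟩⟩).app c w).1)
    (Subtype.ext ((USet.pair_one_val _ _ _).symm.trans h))

theorem one_mul : tensorHom (one C) (𝟙 (elDiagram.{u} C)) ≫ mul C =
    leftUnitor (elDiagram.{u} C) := by
  refine Diagram.hom_ext one_mul_F fun p => ?_
  refine El.functor_heq (congrArg (fun F => F.obj p) one_mul_F)
    (grading_faithful (inferInstance : (𝟭 (Discrete PUnit.{u + 2})).Faithful) p.ψ)
    (((Functor.const _).obj ⟨⟨⟩⟩).prod' (𝟭 C)) ?_ ?_ ?_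
  · refine CategoryTheory.Functor.hext (fun _ => rfl) fun x y f => heq_of_eq (Prod.ext rfl ?_)
    exact (congrArg (· ≫ _) (El.eqToHom_opr _)).trans (Category.id_comp _)
  · refine CategoryTheory.Functor.hext (fun _ => rfl) fun x y f => heq_of_eq (Prod.ext rfl ?_)
    exact (congrArg (· ≫ _) (El.eqToHom_opr _)).trans (Category.id_comp _)
  · intro c x x' h
    obtain ⟨s, t, rfl⟩ := USet.exists_pair x
    refine (congrArg (Gr.map _ _).obj (diagonal_obj_pair _ c s t)).trans ?_
    exact pair_obj_ext rfl ((USet.pair_one_val _ _ _).symm.trans h)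

theorem mul_one_F : (tensorHom (𝟙 (elDiagram.{u} C)) (one C) ≫ mul C).F =
    (rightUnitor (elDiagram.{u} C)).F := by
  have hobj (p : Param (elDiagram.{u} C) unit) :
      (mulF C).obj ((tensorHomF (𝟙 (elDiagram.{u} C)) (one C)).obj p) = p.d := by
    refine presheaf_ext (fun c => USet.sigma_one _) fun {c d} f x y h => ?_
    obtain ⟨s, t, rfl⟩ := USet.exists_pair x
    refine (congrArg Subtype.val (mulF_obj_map_pair _ f s t)).trans ?_
    refine (USet.val_pair_one _ _ _).trans ?_
    exact map_val_congr f ((USet.val_pair_one _ _ _).symm.trans h)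
  refine CategoryTheory.Functor.hext hobj fun p q k => nat_heq (hobj p) (hobj q) fun c x y h => ?_
  obtain ⟨s, t, rfl⟩ := USet.exists_pair x
  refine (congrArg Subtype.val (mulF_map_app_pair _ c s t)).trans ?_
  refine (USet.val_pair_one _ _ _).trans ?_
  exact congrArg (fun w => (k.f.app c w).1)
    (Subtype.ext ((USet.val_pair_one _ _ _).symm.trans h))

/-- When the fibres are points, the category of pairs is graded by its base. -/
def baseGrading {S : C ⥤ USet.{u}} (P : El S ⥤ Cat.{u + 1, u + 1}) : Gr P ⥤ C where
  obj x := x.base.base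
  map f := f.base.opr

theorem baseGrading_faithful {S : C ⥤ USet.{u}} (ψ : El S ⥤ Discrete PUnit.{u + 2}) :
    (baseGrading (ψ ⋙ (unit.{u + 1}).R)).Faithful where
  map_injective h := Gr.hom_ext (El.hom_ext h)
    (Subsingleton.elim (α := (_ : Discrete PUnit) ⟶ _) _ _)

theorem mul_one : tensorHom (𝟙 (elDiagram.{u} C)) (one C) ≫ mul C =
    rightUnitor (elDiagram.{u} C) := by
  refine Diagram.hom_ext mul_one_F fun p => ?_
  refine El.functor_heq (congrArg (fun F => F.obj p) mul_one_F)
    (baseGrading_faithful p.ψ) (𝟭 C) ?_ ?_ ?_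
  · exact CategoryTheory.Functor.hext (fun _ => rfl) fun _ _ _ => HEq.rfl
  · exact CategoryTheory.Functor.hext (fun _ => rfl) fun _ _ _ => HEq.rfl
  · intro c x x' h
    obtain ⟨s, t, rfl⟩ := USet.exists_pair x
    refine (congrArg (Gr.map _ _).obj (diagonal_obj_pair _ c s t)).trans ?_
    exact congrArg (fun a => (⟨a, ⟨⟨⟩⟩⟩ : Gr (p.ψ ⋙ (unit.{u + 1}).R)))
      (El.obj_ext ((USet.val_pair_one _ _ _).symm.trans h))

/-! ### Associativity -/

/-- Pushing forward along `α` after `g` in a fibre does not change the operator of `g`. -/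
theorem ι_push_fiber_opr {S : C ⥤ USet.{u}} (ψ : El S ⥤ C ⥤ USet.{u}) {a b : El S} (α : a ⟶ b)
    {x y : El (ψ.obj a)} (g : x ⟶ y) :
    El.Hom.opr (F := ψ.obj b) ((Gr.ι (ψ ⋙ elR C) a).map g ≫ Gr.push (ψ ⋙ elR C) α y).fiber =
      g.opr := by
  have h : El.Hom.opr (F := ψ.obj a) ((Gr.ι (ψ ⋙ elR C) a).map g).fiber = g.opr :=
    (congrArg (· ≫ _) (El.eqToHom_opr _)).trans (Category.id_comp _)
  refine (congrArg (· ≫ _) (El.eqToHom_opr _)).trans ((Category.id_comp _).trans ?_)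
  exact (Category.comp_id _).trans h

/-- The operator `f` acts on the pair `(s, t)` of the diagonal first within the fibre over `s`, then
along `s ⟶ f s`. -/
theorem diagonal_map_heq (p : Param (elDiagram.{u} C) (elDiagram.{u} C)) {c d : C} (f : c ⟶ d)
    (s : (p.d.obj c).Elem) (t : ((p.ψ.obj (⟨c, s⟩ : El p.d)).obj c).Elem) :
    (diagonal p).map (⟨f, rfl⟩ : (⟨c, USet.pair s t⟩ : El ((mulF C).obj p)) ⟶
        ⟨d, ((mulF C).obj p).map f (USet.pair s t)⟩) ≍
      (Gr.ι (p.ψ ⋙ elR C) (⟨c, s⟩ : El p.d)).map (⟨f, rfl⟩ :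
        (⟨c, t⟩ : El (p.ψ.obj (⟨c, s⟩ : El p.d))) ⟶ ⟨d, (p.ψ.obj (⟨c, s⟩ : El p.d)).map f t⟩) ≫
      Gr.push (p.ψ ⋙ elR C) (⟨f, rfl⟩ : (⟨c, s⟩ : El p.d) ⟶ ⟨d, p.d.map f s⟩)
        (⟨d, (p.ψ.obj (⟨c, s⟩ : El p.d)).map f t⟩ : El (p.ψ.obj (⟨c, s⟩ : El p.d))) := by
  refine heq_of_faithful (grading_faithful (El.proj_faithful p.d) p.ψ) (diagonal_obj_pair p c s t)
    ((congrArg (fun z => (diagonal p).obj ⟨d, z⟩) (mulF_obj_map_pair p f s t)).trans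
      (diagonal_obj_pair p d _ _)) (heq_of_eq ?_)
  refine Prod.ext (Category.id_comp f).symm ?_
  exact (ι_push_fiber_opr p.ψ (⟨f, rfl⟩ : (⟨c, s⟩ : El p.d) ⟶ ⟨d, p.d.map f s⟩) (⟨f, rfl⟩ :
    (⟨c, t⟩ : El (p.ψ.obj (⟨c, s⟩ : El p.d))) ⟶ ⟨d, (p.ψ.obj (⟨c, s⟩ : El p.d)).map f t⟩)).symm

theorem map_obj_val_congr {A : Type*} [Category A] (χ : A ⥤ C ⥤ USet.{u}) {a a' : A} (ha : a = a')
    {c d : C} (f : c ⟶ d) {x : ((χ.obj a).obj c).Elem} {x' : ((χ.obj a').obj c).Elem}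
    (hx : x.1 = x'.1) : ((χ.obj a).map f x).1 = ((χ.obj a').map f x').1 := by
  subst ha
  obtain rfl := Subtype.ext hx
  rfl

theorem map_comp_app_val {A : Type*} [Category A] (χ : A ⥤ C ⥤ USet.{u}) {a b d : A} (f : a ⟶ b)
    (g : b ⟶ d) {c : C} (x : ((χ.obj a).obj c).Elem) :
    ((χ.map (f ≫ g)).app c x).1 = ((χ.map g).app c ((χ.map f).app c x)).1 := by
  rw [χ.map_comp]
  rfl

theorem map_eqToHom_comp_heq {A B : Type*} [Category A] [Category B] (π : A ⥤ B) {a b d : A}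
    (e : a = b) (f : b ⟶ d) : π.map (eqToHom e ≫ f) ≍ π.map f := by
  subst e
  simp

theorem mulF_map_eqToHom_app {p q r : Param (elDiagram.{u} C) (elDiagram.{u} C)} (k : p ⟶ q)
    (h : q = r) {c : C} (x : (((mulF C).obj p).obj c).Elem) :
    (((mulF C).map (k ≫ eqToHom h)).app c x).1 = (((mulF C).map k).app c x).1 := by
  subst h
  simp

theorem φ_app_val_congr {X : Diagram.{u + 1}} {p q : Param X (elDiagram.{u} C)} (k : p ⟶ q)
    {a a' : X.R.obj p.d} (ha : a = a') {c : C} {x : ((p.ψ.obj a).obj c).Elem}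
    {x' : ((p.ψ.obj a').obj c).Elem} (hx : x.1 = x'.1) :
    ((k.φ a).app c x).1 = ((k.φ a').app c x').1 := by
  subst ha
  obtain rfl := Subtype.ext hx
  rfl

section

variable (p : Param (tensor (elDiagram.{u} C) (elDiagram.{u} C)) (elDiagram.{u} C))

/-- The two bracketings of a triple are the same set. The pair `(s, t)` may be given by any `x`
equal to it, as the set in which `u` lives depends on `x`. -/
theorem pair_pair_val {c : C} {x : (((mulF C).obj p.d).obj c).Elem} {s : (p.d.d.obj c).Elem}
    {t : ((p.d.ψ.obj (⟨c, s⟩ : El p.d.d)).obj c).Elem} (hx : x = USet.pair s t)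
    (u : ((p.ψ.obj ((diagonal p.d).obj ⟨c, x⟩)).obj c).Elem)
    (u' : ((p.ψ.obj ⟨(⟨c, s⟩ : El p.d.d),
      (⟨c, t⟩ : El (p.d.ψ.obj (⟨c, s⟩ : El p.d.d)))⟩).obj c).Elem) (hu : u.1 = u'.1) :
    (USet.pair (B := fun x => (p.ψ.obj ((diagonal p.d).obj ⟨c, x⟩)).obj c) x u).1 =
    (USet.pair (B := fun s => USet.sigma ((p.d.ψ.obj (⟨c, s⟩ : El p.d.d)).obj c)
        fun t => (p.ψ.obj ⟨(⟨c, s⟩ : El p.d.d),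
          (⟨c, t⟩ : El (p.d.ψ.obj (⟨c, s⟩ : El p.d.d)))⟩).obj c)
      s (USet.pair t u')).1 := by
  subst hx
  have key (s : (p.d.d.obj c).Elem) (t t' : ((p.d.ψ.obj (⟨c, s⟩ : El p.d.d)).obj c).Elem)
      (ht : t.1 = t'.1) : (p.ψ.obj ((diagonal p.d).obj ⟨c, USet.pair s t⟩)).obj c =
      (p.ψ.obj ⟨(⟨c, s⟩ : El p.d.d), (⟨c, t'⟩ : El (p.d.ψ.obj (⟨c, s⟩ : El p.d.d)))⟩).obj c := by
    obtain rfl := Subtype.ext ht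
    exact congrArg (fun a => (p.ψ.obj a).obj c) (diagonal_obj_pair p.d c s t)
  refine (USet.pair_assoc_val (A := p.d.d.obj c)
    (B := fun s => (p.d.ψ.obj (⟨c, s⟩ : El p.d.d)).obj c)
    (C := fun x => (p.ψ.obj ((diagonal p.d).obj ⟨c, x⟩)).obj c) s t u).trans ?_
  refine USet.pair_val_congr rfl (fun s s' hs => ?_) rfl ?_
  · obtain rfl := Subtype.ext hs
    exact USet.sigma_congr rfl (key s)
  · exact USet.pair_val_congr rfl (key s) rfl hu

theorem assoc_obj_obj (c : C) :
    ((mulF C).obj ((tensorHomF (mul C) (𝟙 (elDiagram.{u} C))).obj p)).obj c =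
      ((mulF C).obj ((tensorHomF (𝟙 (elDiagram.{u} C)) (mul C)).obj ((assocF _ _ _).obj
        p))).obj c := by
  refine (USet.sigma_assoc _ _ _).trans ?_
  refine USet.sigma_congr rfl fun s s' hs => ?_
  obtain rfl := Subtype.ext hs
  refine USet.sigma_congr rfl fun t t' ht => ?_
  obtain rfl := Subtype.ext ht
  exact congrArg (fun a => (p.ψ.obj a).obj c) (diagonal_obj_pair p.d c s t)

/-- Elements of the two bracketings that are the same set encode a common triple; its last entry
appears twice, in two sets that are equal but not by definition. -/
theorem exists_triple (c : C)
    (x : (((mulF C).obj ((tensorHomF (mul C) (𝟙 (elDiagram.{u} C))).obj p)).obj c).Elem)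
    (y : (((mulF C).obj ((tensorHomF (𝟙 (elDiagram.{u} C)) (mul C)).obj
      ((assocF _ _ _).obj p))).obj c).Elem) (h : x.1 = y.1) :
    ∃ (s : (p.d.d.obj c).Elem) (t : ((p.d.ψ.obj (⟨c, s⟩ : El p.d.d)).obj c).Elem)
      (u : ((p.ψ.obj ((diagonal p.d).obj ⟨c, USet.pair s t⟩)).obj c).Elem)
      (u' : ((p.ψ.obj ⟨(⟨c, s⟩ : El p.d.d),
        (⟨c, t⟩ : El (p.d.ψ.obj (⟨c, s⟩ : El p.d.d)))⟩).obj c).Elem),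
      u.1 = u'.1 ∧ x = USet.pair (USet.pair s t) u ∧ y = USet.pair s (USet.pair t u') := by
  obtain ⟨z, u, rfl⟩ := USet.exists_pair x
  obtain ⟨s, t, rfl⟩ := USet.exists_pair z
  have e : (p.ψ.obj ((diagonal p.d).obj ⟨c, USet.pair s t⟩)).obj c =
      (p.ψ.obj ⟨(⟨c, s⟩ : El p.d.d), (⟨c, t⟩ : El (p.d.ψ.obj (⟨c, s⟩ : El p.d.d)))⟩).obj c :=
    congrArg (fun a => (p.ψ.obj a).obj c) (diagonal_obj_pair p.d c s t)
  refine ⟨s, t, u, eqToHom e u, (eqToHom_val e u).symm, rfl, Subtype.ext (h.symm.trans ?_)⟩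
  exact pair_pair_val p rfl u _ (eqToHom_val e u).symm

theorem assoc_obj : (mulF C).obj ((tensorHomF (mul C) (𝟙 (elDiagram.{u} C))).obj p) =
    (mulF C).obj ((tensorHomF (𝟙 (elDiagram.{u} C)) (mul C)).obj ((assocF _ _ _).obj p)) := by
  refine presheaf_ext (assoc_obj_obj p) fun {c d} f x y h => ?_
  obtain ⟨s, t, u, u', hu, rfl, rfl⟩ := exists_triple p c x y h
  refine (congrArg Subtype.val (mulF_obj_map_pair
    ((tensorHomF (mul C) (𝟙 (elDiagram.{u} C))).obj p) f (USet.pair s t) u)).trans ?_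
  refine Eq.trans ?_ (congrArg Subtype.val (mulF_obj_map_pair
    ((tensorHomF (𝟙 (elDiagram.{u} C)) (mul C)).obj ((assocF _ _ _).obj p)) f s
      (USet.pair t u'))).symm
  let α : (⟨c, s⟩ : El p.d.d) ⟶ ⟨d, p.d.d.map f s⟩ := ⟨f, rfl⟩
  let A := curryF (X := elDiagram.{u} C) (Y := elDiagram.{u} C) p.d.ψ p.ψ
  -- On `(s, (t, u'))` the operator `f` acts on the inner pair within the fibre over `s`, then
  -- along `α`.
  have h₁ := mulF_obj_map_pair (A.obj (⟨c, s⟩ : El p.d.d)) f t u'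
  have h₂ := mulF_map_app_pair (A.map α) d ((p.d.ψ.obj (⟨c, s⟩ : El p.d.d)).map f t)
    (((A.obj (⟨c, s⟩ : El p.d.d)).ψ.map (⟨f, rfl⟩ : (⟨c, t⟩ : El (p.d.ψ.obj (⟨c, s⟩ : El p.d.d))) ⟶
      ⟨d, (p.d.ψ.obj (⟨c, s⟩ : El p.d.d)).map f t⟩)).app d
      (((A.obj (⟨c, s⟩ : El p.d.d)).ψ.obj (⟨c, t⟩ : El (p.d.ψ.obj (⟨c, s⟩ : El p.d.d)))).map f u'))
  have h := (congrArg (((mulF C).map (A.map α)).app d) h₁).trans h₂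
  refine Eq.trans ?_ (congrArg (fun v => (USet.pair (B := fun s => USet.sigma
    ((p.d.ψ.obj (⟨d, s⟩ : El p.d.d)).obj d) fun t => (p.ψ.obj ⟨(⟨d, s⟩ : El p.d.d),
      (⟨d, t⟩ : El (p.d.ψ.obj (⟨d, s⟩ : El p.d.d)))⟩).obj d) (p.d.d.map f s) v).1) h).symm
  have e := mulF_obj_map_pair p.d f s t
  refine pair_pair_val p e _ _ ?_
  -- On `((s, t), u)` it acts on `u` along the image of `f` under the diagonal functor, which is the
  -- composite of the corresponding two morphisms.
  have h₃ := map_app_val_congr p.ψ (c := d) (diagonal_obj_pair p.d c s t)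
    ((congrArg (fun z => (diagonal p.d).obj ⟨d, z⟩) e).trans (diagonal_obj_pair p.d d _ _))
    (diagonal_map_heq p.d f s t) (x := (p.ψ.obj _).map f u) (x' := (p.ψ.obj _).map f u')
    (map_obj_val_congr p.ψ (diagonal_obj_pair p.d c s t) f hu)
  exact h₃.trans (map_comp_app_val p.ψ _ _ _)

end

theorem mul_assoc_F : (tensorHom (mul C) (𝟙 (elDiagram.{u} C)) ≫ mul C).F =
    (assoc (elDiagram.{u} C) (elDiagram.{u} C) (elDiagram.{u} C) ≫
      tensorHom (𝟙 (elDiagram.{u} C)) (mul C) ≫ mul C).F := by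
  refine CategoryTheory.Functor.hext assoc_obj fun p q k =>
    nat_heq (assoc_obj p) (assoc_obj q) fun c x y h => ?_
  obtain ⟨s, t, u, u', hu, rfl, rfl⟩ := exists_triple p c x y h
  refine (congrArg Subtype.val (mulF_map_app_pair
    ((tensorHomF (mul C) (𝟙 (elDiagram.{u} C))).map k) c (USet.pair s t) u)).trans ?_
  refine Eq.trans ?_ (congrArg Subtype.val (mulF_map_app_pair
    ((tensorHomF (𝟙 (elDiagram.{u} C)) (mul C)).map ((assocF _ _ _).map k)) c s
      (USet.pair t u'))).symm
  have h₁ := mulF_map_app_pair (((assocF _ _ _).map k).φ (⟨c, s⟩ : El p.d.d)) c t u'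
  have e := mulF_map_app_pair k.f c s t
  have h₂ := mulF_map_eqToHom_app (((assocF _ _ _).map k).φ (⟨c, s⟩ : El p.d.d)) rfl
    (USet.pair t u')
  refine Eq.trans ?_ (congrArg (fun v => (USet.pair (B := fun s => USet.sigma
    ((q.d.ψ.obj (⟨c, s⟩ : El q.d.d)).obj c) fun t => (q.ψ.obj ⟨(⟨c, s⟩ : El q.d.d),
      (⟨c, t⟩ : El (q.d.ψ.obj (⟨c, s⟩ : El q.d.d)))⟩).obj c) (k.f.f.app c s) v).1)
      ((Subtype.ext h₂).trans h₁)).symm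
  refine pair_pair_val q e _ _ ?_
  refine (comp_eqToHom_app_val (k.φ _) _ u).trans ?_
  exact φ_app_val_congr k (diagonal_obj_pair p.d c s t) hu

/-- The rebracketing functor sends `(s, v)`, where `v` encodes `(t, u)`, to `((s, t), u)`; the
operators of the three components of a morphism are read off from those of `s` and `v`. -/
theorem sumAssoc_grading
    (p : Param (tensor (elDiagram.{u} C) (elDiagram.{u} C)) (elDiagram.{u} C)) :
    Hom.comp (tensorHom (𝟙 (elDiagram.{u} C)) (mul C)) ((assocF _ _ _).obj p) ⋙
        Gr.sumAssoc (p.d.ψ ⋙ elR C) (p.ψ ⋙ elR C) ⋙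
        grading (grading (El.proj p.d.d) p.d.ψ) p.ψ =
      grading (El.proj p.d.d) ((tensorHomF (𝟙 (elDiagram.{u} C)) (mul C)).obj
        ((assocF _ _ _).obj p)).ψ ⋙ (𝟭 (C × C)).prod' (CategoryTheory.Prod.snd C C) := by
  refine CategoryTheory.Functor.hext (fun _ => rfl) fun x y f => heq_of_eq ?_
  let A := curryF (X := elDiagram.{u} C) (Y := elDiagram.{u} C) p.d.ψ p.ψ
  let π := grading (El.proj (p.d.ψ.obj y.base)) (Gr.ι (p.d.ψ ⋙ elR C) y.base ⋙ p.ψ)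
  let g := (diagonal (A.obj y.base)).map f.fiber
  -- The transport in `Gr.map` is invisible to the gradings: its source and target have the same
  -- bidegree by definition.
  have h := eq_of_heq (map_eqToHom_comp_heq π
    (Gr.nat_obj (Functor.whiskerLeft A (mul C).ρ) f.base x.fiber) g)
  refine Prod.ext (Prod.ext rfl ?_) ?_
  · exact congrArg Prod.fst h
  · refine (congrArg (· ≫ _) (El.eqToHom_opr _)).trans ((Category.id_comp _).trans ?_)
    exact congrArg Prod.snd h

theorem mul_assoc : tensorHom (mul C) (𝟙 (elDiagram.{u} C)) ≫ mul C =
    assoc (elDiagram.{u} C) (elDiagram.{u} C) (elDiagram.{u} C) ≫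
      tensorHom (𝟙 (elDiagram.{u} C)) (mul C) ≫ mul C := by
  refine Diagram.hom_ext mul_assoc_F fun p => ?_
  refine El.functor_heq (congrArg (fun F => F.obj p) mul_assoc_F)
    (grading_faithful (grading_faithful (El.proj_faithful p.d.d) p.d.ψ) p.ψ)
    ((Functor.diag C).prod' (𝟭 C)) ?_ ?_ ?_
  · refine CategoryTheory.Functor.hext (fun _ => rfl) fun x y f => heq_of_eq
      (Prod.ext (Prod.ext rfl rfl) ?_)
    exact (congrArg (· ≫ _) (El.eqToHom_opr _)).trans (Category.id_comp _)
  · exact (congrArg (diagonal _ ⋙ ·) (sumAssoc_grading p)).trans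
      (congrArg (· ⋙ (𝟭 (C × C)).prod' (CategoryTheory.Prod.snd C C)) (diagonal_grading
        ((tensorHomF (𝟙 (elDiagram.{u} C)) (mul C)).obj ((assocF _ _ _).obj p))))
  · intro c x y h
    obtain ⟨s, t, u, u', hu, rfl, rfl⟩ := exists_triple p c x y h
    refine (congrArg (Gr.map _ _).obj (diagonal_obj_pair
      ((tensorHomF (mul C) (𝟙 (elDiagram.{u} C))).obj p) c (USet.pair s t) u)).trans ?_
    refine (pair_obj_ext (diagonal_obj_pair p.d c s t) hu).trans ?_
    have h' := diagonal_obj_pair ((curryF (X := elDiagram.{u} C) (Y := elDiagram.{u} C)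
      p.d.ψ p.ψ).obj (⟨c, s⟩ : El p.d.d)) c t u'
    refine Eq.trans ?_ (congrArg (fun a => (Gr.sumAssoc (p.d.ψ ⋙ elR C) (p.ψ ⋙ elR C)).obj
      ((Gr.map _ _).obj a)) (diagonal_obj_pair
      ((tensorHomF (𝟙 (elDiagram.{u} C)) (mul C)).obj ((assocF _ _ _).obj p)) c s
      (USet.pair t u'))).symm
    exact (congrArg
      (fun a => (⟨⟨(⟨c, s⟩ : El p.d.d), a.base⟩, a.fiber⟩ : Gr (p.ψ ⋙ elR C))) h').symm

/-- The club structure on the diagram of `USet`-valued functors on `C`. -/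
noncomputable def club (C : Type) [Category.{0} C] : Club (elDiagram.{u} C) where
  mul := mul C
  one := one C
  one_mul := one_mul
  mul_one := mul_one
  mul_assoc := mul_assoc

end ClubSSet

/-- There is a `⋉`-monoid structure (a club structure) on the diagram of simplicial sets whose
multiplication `(Δ, δ)` sends `(𝒮, ψ)` to the diagonal of the bisimplicial set whose category of
simplices is `S ⋉_ψ SSet`, with `δ` given by the diagonal, and whose unit picks out the one-point
simplicial set. -/
theorem mainTheorem1 :
    ∃ M : ClubSSet.Club ClubSSet.SSetDiagram.{u},
      (∀ p : ClubSSet.Diagram.Param ClubSSet.SSetDiagram.{u} ClubSSet.SSetDiagram.{u},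
        ClubSSet.IsDiagonal p (M.mul.F.obj p) (ClubSSet.Diagram.Hom.comp M.mul p)) ∧
      ∀ n : SimplexCategoryᵒᵖ, Nonempty (Unique ((M.one.F.obj ⟨⟨⟩⟩).obj n).Elem) := by
  refine ⟨ClubSSet.club SimplexCategoryᵒᵖ, fun p => ?_,
    fun n => ⟨inferInstanceAs (Unique ClubSSet.USet.one.Elem)⟩⟩
  refine ⟨ClubSSet.bisum p.d p.ψ, ClubSSet.bisumElIso p.d p.ψ, Iso.refl _, ?_, rfl⟩
  exact ClubSSet.bisumElHom_grading p.d p.ψ
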